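/- Let $\beta\ge 0$, $h\in\mathbb R$ and let $X=(X_{ij})_{1\le i<j\le n}$ be the random graph on $n$ vertices (with $X_{ij}=X_{ji}\in\{0,1\}$ the edge indicators) whose law on $\{0,1\}^{\binom n2}$ is proportional to $e^{H(x)}$, where $H(x)=\frac{\beta}{n}T(x)+hE(x)$, $T(x)=\sum_{i<j<k}x_{ij}x_{jk}x_{ik}$ is the number of triangles and $E(x)=\sum_{i<j}x_{ij}$ the number of edges. Let $Z_n(\beta,h)=\sum_x e^{H(x)}$ and $L_{ij}=\frac1n\sum_{k\notin\{i,j\}}X_{ik}X_{jk}$. Put $\varphi(x)=\frac{e^{\beta x+h}}{1+e^{\beta x+h}}$, $\psi(u)=\varphi(u)^2-u$, and $I(r,s)=r\log\frac rs+(1-r)\log\frac{1-r}{1-s}$ for $r,s\in(0,1)$. Suppose that $(h,\beta)=\gamma(t):=\bigl(-\log t-\frac{1+t}{2t},\ \frac{(1+t)^3}{2t}\bigr)$ for some $t>0$, $t\ne\frac12$. Then $\psi$ has exactly two roots in $[0,1]$: one is $v^*=(1+t)^{-2}$, at which $\psi'(v^*)=0$; let $u^*\neq v^*$ be the other one. There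 are constants $K$ and $C>0$ depending only on $\beta,h$ such that the following hold. (a) For all $n$ and all $1\le i<j\le n$, $\ \mathbb E|L_{ij}-u^*|\le K n^{-1/2}$. (b) For all $n\ge1$, $$\left|\frac{\log Z_n(\beta,h)}{n^2}-\left(-\tfrac12 I(\varphi(u^*),\varphi(0))-\tfrac12\log(1-\varphi(0))+\frac{\beta\varphi(u^*)^3}{6}\right)\right|\le Kn^{-1/2}.$$ (c) If $T_n$ is the number of triangles in the Erdős–Rényi graph $G(n,\varphi(0))$, then for all $n\ge1$ $$\mathbb P\left(\Bigl|T_n-\tbinom n3\varphi(u^*)^3\Bigr|\le C n^{5/2}\right)=\exp\left(-\frac{n^2 I(\varphi(u^*),\varphi(0))}{2}(1+\varepsilon_n)\right)\quad\text{with } |\varepsilon_n|\le Kn^{-1/2}.$$ -/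

import Mathlib

noncomputable section

namespace TriangleERG

/-- The function `φ(x) = e^{βx + h} / (1 + e^{βx + h})`. -/
def phi (β h x : ℝ) : ℝ := Real.exp (β * x + h) / (1 + Real.exp (β * x + h))

/-- The function `ψ(u) = φ(u)² - u`. -/
def psi (β h u : ℝ) : ℝ := phi β h u ^ 2 - u

theorem phi_mem_unitInterval (β h x : ℝ) : phi β h x ∈ unitInterval := by
  have hpos := Real.exp_pos (β * x + h)
  refine ⟨by unfold phi; positivity, ?_⟩
  unfold phi
  rw [div_le_one (by positivity)]
  linarith

/-- The edge probability `φ(0)`, as an element of the unit interval. -/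
def baseProb (β h : ℝ) : unitInterval := ⟨phi β h 0, phi_mem_unitInterval β h 0⟩

/-- The relative entropy `I(r, s)` of Bernoulli(`r`) with respect to Bernoulli(`s`),
for `r, s ∈ (0, 1)`. -/
def relEnt (r s : ℝ) : ℝ := r * Real.log (r / s) + (1 - r) * Real.log ((1 - r) / (1 - s))

/-- The phase transition curve `γ(t) = (h, β)`, for `t > 0`. -/
def gammaCurve (t : ℝ) : ℝ × ℝ := (-Real.log t - (1 + t) / (2 * t), (1 + t) ^ 3 / (2 * t))

section Graphs

variable {n : ℕ}

open Classical in
/-- The edge variable `x_{ij} = x_{ji} ∈ {0, 1}` of a graph on `n` vertices.  The configuration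
space `{0,1}^{n choose 2}` is identified with the set of graphs on the vertex set `Fin n`. -/
def edgeVar (G : SimpleGraph (Fin n)) (i j : Fin n) : ℝ := if G.Adj i j then 1 else 0

/-- The number of edges `E(x) = ∑_{i<j} x_{ij}`. -/
def numEdges (G : SimpleGraph (Fin n)) : ℝ :=
  ∑ i : Fin n, ∑ j : Fin n, if i < j then edgeVar G i j else 0

/-- The number of triangles `T(x) = ∑_{i<j<k} x_{ij} x_{jk} x_{ik}`. -/
def numTriangles (G : SimpleGraph (Fin n)) : ℝ :=
  ∑ i : Fin n, ∑ j : Fin n, ∑ k : Fin n,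
    if i < j ∧ j < k then edgeVar G i j * edgeVar G j k * edgeVar G i k else 0

/-- `L_{ij} = n⁻¹ ∑_{k ∉ {i,j}} x_{ik} x_{jk}`, the normalized number of wedges with base `ij`. -/
def wedge (G : SimpleGraph (Fin n)) (i j : Fin n) : ℝ :=
  (1 / (n : ℝ)) * ∑ k ∈ Finset.univ \ {i, j}, edgeVar G i k * edgeVar G j k

/-- The Hamiltonian `H(x) = (β/n) T(x) + h E(x)`. -/
def hamiltonian (β h : ℝ) (G : SimpleGraph (Fin n)) : ℝ :=
  β / (n : ℝ) * numTriangles G + h * numEdges G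

/-- The partition function `Z_n(β, h) = ∑_x e^{H(x)}`. -/
def partitionFn (n : ℕ) (β h : ℝ) : ℝ :=
  ∑ G : SimpleGraph (Fin n), Real.exp (hamiltonian β h G)

/-- The expectation of `f(X)`, where `X` has the law on graphs proportional to `e^{H(x)}`. -/
def gibbsExp (β h : ℝ) (f : SimpleGraph (Fin n) → ℝ) : ℝ :=
  ∑ G : SimpleGraph (Fin n), f G * (Real.exp (hamiltonian β h G) / partitionFn n β h)

end Graphs

end TriangleERG

end

noncomputable section
namespace TriangleERG

/-! Toggling one edge changes `H` by `β L_ab + h`, so given all other edges `ab` is present with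
probability `φ(L_ab)` (`gibbsExp_edge_sub_phi_mul`). It follows that weighted row sums of `X_ik -
φ(L_ik)` have sixth moment `O(n³)` (`exists_gibbsExp_rowFluct_pow_six_le`). Thus `L` almost solves
the mean-field system `L_ij = n⁻¹ ∑_k φ(L_ik) φ(L_jk)`, with error of order `n^(-1/2)`.

The constant solutions of the limiting system are the roots of `ψ`. At `u` the slope of `ψ` is
negative, so `2 φ(u) φ'(u) < 1` and the system contracts. At `v` the slope vanishes, that factor is
exactly 1, and contraction fails. Instead one looks at the extreme values of `L`
(`exists_dichotomy`). If neither strays from the right side of `u`, every entry is near `u`.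
Otherwise the minimum or the maximum is near `v`, so all entries lie essentially on one side of `v`.
Deviations from `v` then cannot cancel, and the system forces `L` to be near `v` on average.

The second alternative is excluded energetically. Configurations that are near a root `w` on average
contribute to `Z_n` about `exp(n² freeEnergy w)` at most (`gibbsProb_mul_partitionFn_near_le`),
while a product trial measure gives at least `exp(n² freeEnergy u - O(n))` (`freeEnergy_lower`).
Moreover `freeEnergy v < freeEnergy u` (`freeEnergy_lt`): both are values of one function whose
derivative has the sign of `ψ`, and `ψ` changes sign only at `u`. So `L` is uniformly near `u`
outside an event of probability `O(n^(-1/2))`, and contraction upgrades this to (a).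

Edge and triangle counts are determined by `L` up to small fluctuations, so (a) makes the upper and
lower bounds on `log Z_n` match, which is (b). For (c), the Gibbs measure is a tilt of the
Erdős–Rényi measure by `exp(βT/n)`. This tilt is nearly constant on the triangle event, and the
event has Gibbs probability at least 1/2, so its Erdős–Rényi probability is read off from the ratio
of partition functions. -/

/-! ### The roots of `ψ` on the transition curve -/

/-- The log-odds form of `ψ` in the coordinate `s`, where `x = (1 + s)⁻²`. -/
def critFn (β h s : ℝ) : ℝ := β * ((1 + s) ^ 2)⁻¹ + h + Real.log s

/-- The quadratic cofactor of `s - t` in the numerator of `critFn'`. -/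
def critQuad (t s : ℝ) : ℝ := t * s ^ 2 + (t ^ 2 + 3 * t) * s - 1

/-- On the curve the numerator of the derivative is `t(1+s)³ - (1+t)³s`, which vanishes at `s = t`;
the factor `s - t` is what makes the root at `t` a double one. -/
theorem hasDerivAt_critFn {t h β : ℝ} (ht : 0 < t) (hγ : (h, β) = gammaCurve t) {s : ℝ}
    (hs : 0 < s) :
    HasDerivAt (critFn β h) ((s - t) * critQuad t s / (t * s * (1 + s) ^ 3)) s := by
  obtain ⟨-, hβ⟩ := Prod.mk.inj hγ
  have h1 : HasDerivAt (fun s : ℝ => (1 + s) ^ 2) (2 * (1 + s)) s := by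
    simpa using ((hasDerivAt_id s).const_add 1).fun_pow 2
  have h2 := (((h1.inv (by positivity)).const_mul β).add_const h).add (Real.hasDerivAt_log hs.ne')
  refine h2.congr_deriv ?_
  rw [hβ, critQuad]
  field_simp
  ring

theorem critFn_self {t h β : ℝ} (ht : 0 < t) (hγ : (h, β) = gammaCurve t) : critFn β h t = 0 := by
  obtain ⟨hh, hβ⟩ := Prod.mk.inj hγ
  rw [critFn, hh, hβ]
  field_simp
  ring

theorem critQuad_strictMonoOn {t : ℝ} (ht : 0 < t) : StrictMonoOn (critQuad t) (Set.Ici 0) := by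
  intro a ha b hb hab
  simp only [Set.mem_Ici] at ha hb
  simp only [critQuad]
  have : 0 < (b - a) * (t * (a + b) + (t ^ 2 + 3 * t)) := by
    have := sub_pos.2 hab
    positivity
  nlinarith

theorem exists_critQuad_root {t : ℝ} (ht : 0 < t) : ∃ r, 0 < r ∧ critQuad t r = 0 := by
  have hc : ContinuousOn (critQuad t) (Set.Icc 0 (1 / t)) := by
    unfold critQuad; fun_prop
  have h0 : critQuad t 0 = -1 := by simp [critQuad]
  have h1 : 0 ≤ critQuad t (1 / t) := by
    have : critQuad t (1 / t) = 1 / t + t + 2 := by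
      rw [critQuad]; field_simp; ring
    rw [this]; positivity
  obtain ⟨r, hr, hr0⟩ := intermediate_value_Icc (by positivity) hc
    (show (0 : ℝ) ∈ Set.Icc _ _ from ⟨by rw [h0]; norm_num, h1⟩)
  refine ⟨r, lt_of_le_of_ne hr.1 ?_, hr0⟩
  rintro rfl
  rw [h0] at hr0; norm_num at hr0

/-- The only critical points are `t` and the positive root `r` of `critQuad`, so `critFn` is up,
down, up. It vanishes at the critical point `t`, hence has exactly one further zero, on the outer
branch beyond `r`. The positive product says that the derivative at that zero is positive, so the
crossing there is transversal. -/
theorem exists_critFn_roots {t h β : ℝ} (ht : 0 < t) (ht' : t ≠ 1 / 2)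
    (hγ : (h, β) = gammaCurve t) :
    ∃ s, 0 < s ∧ s ≠ t ∧ 0 < (s - t) * critQuad t s ∧
      ∀ x, 0 < x → (critFn β h x = 0 ↔ x = s ∨ x = t) := by
  obtain ⟨hh, hβ⟩ := Prod.mk.inj hγ
  have hβ0 : 0 < β := by rw [hβ]; positivity
  have hk0 := critFn_self ht hγ
  obtain ⟨r, hr, hQr⟩ := exists_critQuad_root ht
  have hQt : critQuad t t = (t + 1) ^ 2 * (2 * t - 1) := by rw [critQuad]; ring
  have hder : ∀ s, 0 < s → deriv (critFn β h) s = (s - t) * critQuad t s / (t * s * (1 + s) ^ 3) :=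
    fun s hs => (hasDerivAt_critFn ht hγ hs).deriv
  have hcont : ContinuousOn (critFn β h) (Set.Ioi 0) := fun s hs =>
    (hasDerivAt_critFn ht hγ hs).continuousAt.continuousWithinAt
  have hQm := critQuad_strictMonoOn ht
  have hQneg : ∀ s, 0 < s → s < r → critQuad t s < 0 := fun s hs h => by
    rw [← hQr]; exact hQm hs.le hr.le h
  have hQpos : ∀ s, r < s → 0 < critQuad t s := fun s h => by
    rw [← hQr]; exact hQm hr.le (hr.trans h).le h
  have hmono : ∀ D : Set ℝ, Convex ℝ D → D ⊆ Set.Ioi 0 →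
      (∀ s ∈ interior D, 0 < (s - t) * critQuad t s) → StrictMonoOn (critFn β h) D := by
    intro D hD hD0 hpos
    refine strictMonoOn_of_deriv_pos hD (hcont.mono hD0) fun s hs => ?_
    have hs0 : 0 < s := hD0 (interior_subset hs)
    rw [hder s hs0]
    exact div_pos (hpos s hs) (by positivity)
  have hanti : ∀ D : Set ℝ, Convex ℝ D → D ⊆ Set.Ioi 0 →
      (∀ s ∈ interior D, (s - t) * critQuad t s < 0) → StrictAntiOn (critFn β h) D := by
    intro D hD hD0 hpos
    refine strictAntiOn_of_deriv_neg hD (hcont.mono hD0) fun s hs => ?_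
    have hs0 : 0 < s := hD0 (interior_subset hs)
    rw [hder s hs0]
    exact div_neg_of_neg_of_pos (hpos s hs) (by positivity)
  -- The sign of `critQuad t t = (t+1)²(2t-1)` decides on which side of `t` the point `r` lies. For
  -- `t < 1/2`, `t` is a local maximum and the extra zero lies above `r`; for `t > 1/2`, `t` is a
  -- local minimum and it lies below `r`.
  rcases lt_or_gt_of_ne ht' with hlt | hgt
  · have htr : t < r := by
      by_contra hcon
      have := hQm.monotoneOn hr.le ht.le (not_lt.1 hcon)
      rw [hQr, hQt] at this
      nlinarith [sq_nonneg (t + 1), sq_pos_of_pos (by linarith : 0 < t + 1)]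
    have m1 := hmono (Set.Ioc 0 t) (convex_Ioc _ _) (fun x hx => hx.1) (by
      rw [interior_Ioc]
      exact fun s hs => mul_pos_of_neg_of_neg (sub_neg.2 hs.2) (hQneg s hs.1 (hs.2.trans htr)))
    have m2 := hanti (Set.Icc t r) (convex_Icc _ _) (fun x hx => ht.trans_le hx.1) (by
      rw [interior_Icc]
      exact fun s hs => mul_neg_of_pos_of_neg (sub_pos.2 hs.1) (hQneg s (ht.trans hs.1) hs.2))
    have m3 := hmono (Set.Ici r) (convex_Ici _) (fun x hx => hr.trans_le hx) (by
      rw [interior_Ici]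
      exact fun s hs => mul_pos (sub_pos.2 (htr.trans hs)) (hQpos s hs))
    have n1 : ∀ x, 0 < x → x < t → critFn β h x < 0 := fun x hx hxt => by
      rw [← hk0]; exact m1 ⟨hx, hxt.le⟩ ⟨ht, le_rfl⟩ hxt
    have n2 : ∀ x, t < x → x ≤ r → critFn β h x < 0 := fun x hx hxt => by
      rw [← hk0]; exact m2 ⟨le_rfl, htr.le⟩ ⟨hx.le, hxt⟩ hx
    -- At this point `h + log s = 1`, and the remaining term is positive.
    have hS : 0 < critFn β h (Real.exp (1 - h)) := by
      rw [critFn, Real.log_exp]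
      have : 0 < β * ((1 + Real.exp (1 - h)) ^ 2)⁻¹ := by positivity
      linarith
    have hrS : r < Real.exp (1 - h) := by
      by_contra hcon
      rcases lt_trichotomy (Real.exp (1 - h)) t with hc | hc | hc
      · exact absurd (n1 _ (Real.exp_pos _) hc) hS.not_gt
      · rw [hc, hk0] at hS; exact lt_irrefl _ hS
      · exact absurd (n2 _ hc (not_lt.1 hcon)) hS.not_gt
    obtain ⟨s, hs, hs0⟩ := intermediate_value_Icc hrS.le
      (hcont.mono fun x hx => hr.trans_le hx.1)
      (show (0 : ℝ) ∈ Set.Icc _ _ from ⟨(n2 r htr le_rfl).le, hS.le⟩)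
    have hrs : r < s := lt_of_le_of_ne hs.1 (by rintro rfl; exact (n2 r htr le_rfl).ne hs0)
    refine ⟨s, hr.trans hrs, (htr.trans hrs).ne', mul_pos (sub_pos.2 (htr.trans hrs)) (hQpos s hrs),
      fun x hx => ⟨fun hx0 => ?_, ?_⟩⟩
    · rcases lt_trichotomy x t with hc | hc | hc
      · exact absurd hx0 (n1 x hx hc).ne
      · exact Or.inr hc
      · rcases le_or_gt x r with hc' | hc'
        · exact absurd hx0 (n2 x hc hc').ne
        · exact Or.inl (m3.injOn hc'.le hrs.le (hx0.trans hs0.symm))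
    · rintro (rfl | rfl)
      · exact hs0
      · exact hk0
  · have htr : r < t := by
      by_contra hcon
      have := hQm.monotoneOn ht.le hr.le (not_lt.1 hcon)
      rw [hQr, hQt] at this
      nlinarith [sq_nonneg (t + 1), sq_pos_of_pos (by linarith : 0 < t + 1)]
    have m1 := hmono (Set.Ioc 0 r) (convex_Ioc _ _) (fun x hx => hx.1) (by
      rw [interior_Ioc]
      exact fun s hs => mul_pos_of_neg_of_neg (sub_neg.2 (hs.2.trans htr)) (hQneg s hs.1 hs.2))
    have m2 := hanti (Set.Icc r t) (convex_Icc _ _) (fun x hx => hr.trans_le hx.1) (by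
      rw [interior_Icc]
      exact fun s hs => mul_neg_of_neg_of_pos (sub_neg.2 hs.2) (hQpos s hs.1))
    have m3 := hmono (Set.Ici t) (convex_Ici _) (fun x hx => ht.trans_le hx) (by
      rw [interior_Ici]
      exact fun s hs => mul_pos (sub_pos.2 hs) (hQpos s (htr.trans hs)))
    have n1 : ∀ x, t < x → 0 < critFn β h x := fun x hx => by
      rw [← hk0]; exact m3 (Set.mem_Ici.2 le_rfl) hx.le hx
    have n2 : ∀ x, r ≤ x → x < t → 0 < critFn β h x := fun x hx hxt => by
      rw [← hk0]; exact m2 ⟨hx, hxt.le⟩ ⟨htr.le, le_rfl⟩ hxt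
    -- Here `h + log s = -1 - β`, and the remaining term is at most `β`.
    have hS : critFn β h (Real.exp (-1 - h - β)) < 0 := by
      rw [critFn, Real.log_exp]
      have : β * ((1 + Real.exp (-1 - h - β)) ^ 2)⁻¹ ≤ β * 1 := by
        refine mul_le_mul_of_nonneg_left (inv_le_one_of_one_le₀ ?_) hβ0.le
        exact one_le_pow₀ (by linarith [Real.exp_pos (-1 - h - β)])
      linarith
    have hrS : Real.exp (-1 - h - β) < r := by
      by_contra hcon
      rcases lt_trichotomy (Real.exp (-1 - h - β)) t with hc | hc | hc
      · exact absurd (n2 _ (not_lt.1 hcon) hc) hS.not_gt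
      · rw [hc, hk0] at hS; exact lt_irrefl _ hS
      · exact absurd (n1 _ hc) hS.not_gt
    obtain ⟨s, hs, hs0⟩ := intermediate_value_Icc hrS.le
      (hcont.mono fun x hx => (Real.exp_pos _).trans_le hx.1)
      (show (0 : ℝ) ∈ Set.Icc _ _ from ⟨hS.le, (n2 r le_rfl htr).le⟩)
    have hsp : 0 < s := (Real.exp_pos _).trans_le hs.1
    have hrs : s < r := lt_of_le_of_ne hs.2 (by rintro rfl; exact (n2 s le_rfl htr).ne' hs0)
    refine ⟨s, hsp, (hrs.trans htr).ne,
      mul_pos_of_neg_of_neg (sub_neg.2 (hrs.trans htr)) (hQneg s hsp hrs),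
      fun x hx => ⟨fun hx0 => ?_, ?_⟩⟩
    · rcases lt_trichotomy x t with hc | hc | hc
      · rcases le_or_gt r x with hc' | hc'
        · exact absurd hx0 (n2 x hc' hc).ne'
        · exact Or.inl (m1.injOn ⟨hx, hc'.le⟩ ⟨hsp, hrs.le⟩ (hx0.trans hs0.symm))
      · exact Or.inr hc
      · exact absurd hx0 (n1 x hc).ne'
    · rintro (rfl | rfl)
      · exact hs0
      · exact hk0

theorem phi_pos (β h x : ℝ) : 0 < phi β h x := by
  unfold phi; positivity

theorem phi_lt_one (β h x : ℝ) : phi β h x < 1 := by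
  unfold phi
  rw [div_lt_one (by positivity)]
  linarith

theorem one_sub_phi (β h x : ℝ) : 1 - phi β h x = (1 + Real.exp (β * x + h))⁻¹ := by
  unfold phi; field_simp; ring

theorem log_one_sub_phi (β h x : ℝ) :
    Real.log (1 - phi β h x) = -Real.log (1 + Real.exp (β * x + h)) := by
  rw [one_sub_phi, Real.log_inv]

theorem log_phi (β h x : ℝ) :
    Real.log (phi β h x) = β * x + h + Real.log (1 - phi β h x) := by
  rw [log_one_sub_phi, phi, Real.log_div (Real.exp_pos _).ne' (by positivity), Real.log_exp]
  ring

theorem phi_eq_inv (β h x : ℝ) : phi β h x = (1 + Real.exp (-(β * x + h)))⁻¹ := by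
  unfold phi
  rw [Real.exp_neg]
  field_simp
  ring

theorem hasDerivAt_phi (β h x : ℝ) :
    HasDerivAt (phi β h) (β * (phi β h x * (1 - phi β h x))) x := by
  have h1 : HasDerivAt (fun x => Real.exp (β * x + h)) (Real.exp (β * x + h) * β) x := by
    simpa using (((hasDerivAt_id x).const_mul β).add_const h).exp
  have h2 := h1.div (h1.const_add 1) (by positivity)
  refine h2.congr_deriv ?_
  rw [one_sub_phi, phi]
  field_simp
  ring

theorem hasDerivAt_psi (β h x : ℝ) :
    HasDerivAt (psi β h) (2 * phi β h x * (β * (phi β h x * (1 - phi β h x))) - 1) x := by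
  have := ((hasDerivAt_phi β h x).pow 2).sub (hasDerivAt_id x)
  refine this.congr_deriv ?_
  simp

theorem continuous_phi (β h : ℝ) : Continuous (phi β h) :=
  continuous_iff_continuousAt.2 fun x => (hasDerivAt_phi β h x).continuousAt

theorem continuous_psi (β h : ℝ) : Continuous (psi β h) :=
  continuous_iff_continuousAt.2 fun x => (hasDerivAt_psi β h x).continuousAt

/-- The parameter is `s = exp(-(βx+h)) = (1-φ)/φ`, so that `φ(x) = (1+s)⁻¹` and a root is exactly a
point with `x = (1+s)⁻²`. -/
theorem psi_eq_zero_iff (β h x : ℝ) :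
    psi β h x = 0 ↔ ∃ s, 0 < s ∧ x = ((1 + s) ^ 2)⁻¹ ∧ critFn β h s = 0 := by
  rw [psi, sub_eq_zero, phi_eq_inv]
  constructor
  · intro hx
    refine ⟨_, Real.exp_pos _, by rw [← hx, inv_pow], ?_⟩
    rw [critFn, Real.log_exp, ← inv_pow, hx]
    ring
  · rintro ⟨s, hs, hx, hk⟩
    have : -(β * x + h) = Real.log s := by
      rw [critFn, ← hx] at hk; linarith
    rw [this, Real.exp_log hs, hx, inv_pow]

theorem phi_inv_sq {β h s : ℝ} (hs : 0 < s) (hk : critFn β h s = 0) :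
    phi β h ((1 + s) ^ 2)⁻¹ = (1 + s)⁻¹ := by
  have : -(β * ((1 + s) ^ 2)⁻¹ + h) = Real.log s := by
    rw [critFn] at hk; linarith
  rw [phi_eq_inv, this, Real.exp_log hs]

/-- On the transition curve `ψ` has exactly one root `u` besides the tangential root `v`, and it
crosses zero downwards at `u`. -/
theorem exists_transversal_root {t h β : ℝ} (ht : 0 < t) (ht' : t ≠ 1 / 2)
    (hγ : (h, β) = gammaCurve t) :
    ∃ u, u ≠ ((1 + t) ^ 2)⁻¹ ∧ (∀ x, psi β h x = 0 ↔ x = u ∨ x = ((1 + t) ^ 2)⁻¹) ∧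
      u ∈ Set.Ioo 0 1 ∧ 2 * phi β h u * (β * (phi β h u * (1 - phi β h u))) < 1 := by
  obtain ⟨s, hs, hst, hQ, hroots⟩ := exists_critFn_roots ht ht' hγ
  obtain ⟨-, hβ⟩ := Prod.mk.inj hγ
  have hks : critFn β h s = 0 := (hroots s hs).2 (Or.inl rfl)
  refine ⟨((1 + s) ^ 2)⁻¹, ?_, fun x => ?_, ⟨by positivity, ?_⟩, ?_⟩
  · intro he
    rw [inv_inj, sq_eq_sq₀ (by positivity) (by positivity)] at he
    exact hst (by linarith)
  · rw [psi_eq_zero_iff]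
    constructor
    · rintro ⟨r, hr, rfl, hk⟩
      rcases (hroots r hr).1 hk with rfl | rfl
      · exact Or.inl rfl
      · exact Or.inr rfl
    · rintro (rfl | rfl)
      · exact ⟨s, hs, rfl, hks⟩
      · exact ⟨t, ht, rfl, critFn_self ht hγ⟩
  · exact inv_lt_one_of_one_lt₀ (one_lt_pow₀ (by linarith) two_ne_zero)
  · rw [phi_inv_sq hs hks, hβ]
    -- Up to a positive factor, `-ψ'` at the root is the derivative of `critFn` at `s`, so the
    -- transversality found there becomes a downward crossing of `ψ`.
    have h1 : 2 * (1 + s)⁻¹ * ((1 + t) ^ 3 / (2 * t) * ((1 + s)⁻¹ * (1 - (1 + s)⁻¹)))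
        = 1 - (s - t) * critQuad t s / (t * (1 + s) ^ 3) := by
      rw [critQuad]; field_simp; ring
    rw [h1]
    have : 0 < (s - t) * critQuad t s / (t * (1 + s) ^ 3) := div_pos hQ (by positivity)
    linarith

theorem deriv_psi_tangential {t h β : ℝ} (ht : 0 < t) (hγ : (h, β) = gammaCurve t) :
    deriv (psi β h) ((1 + t) ^ 2)⁻¹ = 0 := by
  rw [(hasDerivAt_psi β h _).deriv, phi_inv_sq ht (critFn_self ht hγ)]
  obtain ⟨-, hβ⟩ := Prod.mk.inj hγ
  rw [hβ]; field_simp; ring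

/-! ### Edge variables and the Hamiltonian -/

section Graph
variable {n : ℕ}

theorem edgeVar_symm (G : SimpleGraph (Fin n)) (i j : Fin n) : edgeVar G i j = edgeVar G j i := by
  unfold edgeVar
  by_cases hG : G.Adj i j
  · rw [if_pos hG, if_pos hG.symm]
  · rw [if_neg hG, if_neg fun h => hG h.symm]

@[simp]
theorem edgeVar_self (G : SimpleGraph (Fin n)) (i : Fin n) : edgeVar G i i = 0 := by
  simp [edgeVar]

theorem edgeVar_nonneg (G : SimpleGraph (Fin n)) (i j : Fin n) : 0 ≤ edgeVar G i j := by
  unfold edgeVar; split_ifs <;> norm_num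

theorem edgeVar_le_one (G : SimpleGraph (Fin n)) (i j : Fin n) : edgeVar G i j ≤ 1 := by
  unfold edgeVar; split_ifs <;> norm_num

theorem wedge_eq (G : SimpleGraph (Fin n)) (i j : Fin n) :
    wedge G i j = (1 / (n : ℝ)) * ∑ k, edgeVar G i k * edgeVar G j k := by
  unfold wedge
  congr 1
  refine Finset.sum_subset (Finset.subset_univ _) fun k _ hk => ?_
  simp only [Finset.mem_sdiff, Finset.mem_univ, true_and, not_not, Finset.mem_insert,
    Finset.mem_singleton] at hk
  rcases hk with rfl | rfl <;> simp

theorem wedge_symm (G : SimpleGraph (Fin n)) (i j : Fin n) : wedge G i j = wedge G j i := by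
  simp only [wedge_eq, mul_comm (edgeVar G i _)]

theorem natCast_mul_wedge (G : SimpleGraph (Fin n)) (i j : Fin n) :
    (n : ℝ) * wedge G i j = ∑ k, edgeVar G i k * edgeVar G j k := by
  have : (n : ℝ) ≠ 0 := by exact_mod_cast (Fin.pos i).ne'
  rw [wedge_eq]; field_simp

theorem wedge_nonneg (G : SimpleGraph (Fin n)) (i j : Fin n) : 0 ≤ wedge G i j := by
  rw [wedge_eq]
  exact mul_nonneg (by positivity) (Finset.sum_nonneg fun k _ =>
    mul_nonneg (edgeVar_nonneg _ _ _) (edgeVar_nonneg _ _ _))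

theorem wedge_le_one (G : SimpleGraph (Fin n)) (i j : Fin n) : wedge G i j ≤ 1 := by
  have hn : (0 : ℝ) < n := by exact_mod_cast Fin.pos i
  have h1 : ∑ k, edgeVar G i k * edgeVar G j k ≤ ∑ _k : Fin n, (1 : ℝ) :=
    Finset.sum_le_sum fun k _ => mul_le_one₀ (edgeVar_le_one _ _ _) (edgeVar_nonneg _ _ _)
      (edgeVar_le_one _ _ _)
  rw [← natCast_mul_wedge] at h1
  simp only [Finset.sum_const, Finset.card_univ, Fintype.card_fin, nsmul_eq_mul, mul_one] at h1
  exact le_of_mul_le_mul_left (by simpa using h1) hn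

theorem two_mul_numEdges (G : SimpleGraph (Fin n)) :
    2 * numEdges G = ∑ i, ∑ j, edgeVar G i j := by
  have h1 : ∀ i j : Fin n, edgeVar G i j =
      (if i < j then edgeVar G i j else 0) + (if j < i then edgeVar G j i else 0) := by
    intro i j
    rcases lt_trichotomy i j with hc | rfl | hc
    · simp [hc, hc.not_gt]
    · simp
    · simp [hc, hc.not_gt, edgeVar_symm G i j]
  calc 2 * numEdges G
      = (∑ i, ∑ j, if i < j then edgeVar G i j else 0)
        + ∑ j, ∑ i, if j < i then edgeVar G j i else 0 := by rw [numEdges]; ring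
    _ = _ := by
        rw [Finset.sum_congr rfl fun i _ => Finset.sum_congr rfl fun j _ => h1 i j]
        simp only [Finset.sum_add_distrib]
        congr 1
        exact Finset.sum_comm

theorem six_mul_numTriangles (G : SimpleGraph (Fin n)) :
    6 * numTriangles G = ∑ i, ∑ j, ∑ k, edgeVar G i j * edgeVar G j k * edgeVar G i k := by
  set F : Fin n → Fin n → Fin n → ℝ := fun i j k =>
    if i < j ∧ j < k then edgeVar G i j * edgeVar G j k * edgeVar G i k else 0 with hF
  have h1 : ∀ i j k : Fin n, edgeVar G i j * edgeVar G j k * edgeVar G i k =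
      F i j k + F i k j + F j i k + F j k i + F k i j + F k j i := by
    intro i j k
    have e1 := edgeVar_symm G i j
    have e2 := edgeVar_symm G j k
    have e3 := edgeVar_symm G i k
    simp only [hF]
    by_cases a : i = j
    · subst a; simp
    by_cases b : j = k
    · subst b; simp
    by_cases c : i = k
    · subst c; simp
    rcases lt_or_gt_of_ne a with a | a <;> rcases lt_or_gt_of_ne b with b | b <;>
      rcases lt_or_gt_of_ne c with c | c <;>
      first
        | (exfalso; omega)
        | (simp only [a, b, c, a.not_gt, b.not_gt, c.not_gt, and_true, and_false,
            if_true, if_false, ← e1, ← e2, ← e3]; ring)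
  have s2 : ∑ i, ∑ j, ∑ k, F i k j = ∑ i, ∑ j, ∑ k, F i j k :=
    Finset.sum_congr rfl fun i _ => Finset.sum_comm
  have s3 : ∑ i, ∑ j, ∑ k, F j i k = ∑ i, ∑ j, ∑ k, F i j k := Finset.sum_comm
  have s4 : ∑ i, ∑ j, ∑ k, F j k i = ∑ i, ∑ j, ∑ k, F i j k := by
    rw [Finset.sum_comm]
    exact Finset.sum_congr rfl fun i _ => Finset.sum_comm
  have s5 : ∑ i, ∑ j, ∑ k, F k i j = ∑ i, ∑ j, ∑ k, F i j k := by
    exact (Finset.sum_congr rfl fun i _ => Finset.sum_comm).trans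
      (Finset.sum_comm.trans (Finset.sum_congr rfl fun i _ => rfl))
  have s6 : ∑ i, ∑ j, ∑ k, F k j i = ∑ i, ∑ j, ∑ k, F i j k := by
    rw [← s4]
    exact Finset.sum_congr rfl fun i _ => Finset.sum_comm
  simp only [h1, Finset.sum_add_distrib]
  rw [s2, s3, s4, s5, s6]
  change 6 * (∑ i, ∑ j, ∑ k, F i j k) = _
  ring

theorem six_mul_numTriangles_eq_wedge (G : SimpleGraph (Fin n)) :
    6 * numTriangles G = n * ∑ i, ∑ j, edgeVar G i j * wedge G i j := by
  rw [six_mul_numTriangles, Finset.mul_sum]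
  refine Finset.sum_congr rfl fun i _ => ?_
  rw [Finset.mul_sum]
  refine Finset.sum_congr rfl fun j _ => ?_
  rw [mul_left_comm, natCast_mul_wedge, Finset.mul_sum]
  exact Finset.sum_congr rfl fun k _ => by ring

theorem edgeVar_sdiff_edge (G : SimpleGraph (Fin n)) {a b : Fin n} (hab : a ≠ b) (k l : Fin n) :
    edgeVar (G \ SimpleGraph.edge a b) k l =
      if (k = a ∧ l = b) ∨ (k = b ∧ l = a) then 0 else edgeVar G k l := by
  have hiff : (G \ SimpleGraph.edge a b).Adj k l ↔
      G.Adj k l ∧ ¬((k = a ∧ l = b) ∨ (k = b ∧ l = a)) := by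
    rw [SimpleGraph.sdiff_adj, SimpleGraph.edge_adj]
    grind
  unfold edgeVar
  by_cases h1 : (k = a ∧ l = b) ∨ (k = b ∧ l = a)
  · rw [if_pos h1, if_neg fun h => (hiff.1 h).2 h1]
  · rw [if_neg h1]
    by_cases h2 : G.Adj k l
    · rw [if_pos h2, if_pos (hiff.2 ⟨h2, h1⟩)]
    · rw [if_neg h2, if_neg fun h => h2 (hiff.1 h).1]

theorem wedge_sdiff_edge_self (G : SimpleGraph (Fin n)) {a b : Fin n} (hab : a ≠ b) :
    wedge (G \ SimpleGraph.edge a b) a b = wedge G a b := by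
  simp only [wedge_eq, edgeVar_sdiff_edge G hab]
  congr 1
  refine Finset.sum_congr rfl fun k _ => ?_
  by_cases h1 : k = a
  · subst h1; simp
  by_cases h2 : k = b
  · subst h2; simp
  simp [h1, h2]

theorem edgeVar_sub_sdiff_edge {G : SimpleGraph (Fin n)} {a b : Fin n} (hG : G.Adj a b)
    (k l : Fin n) :
    edgeVar G k l = edgeVar (G \ SimpleGraph.edge a b) k l +
      ((if k = a ∧ l = b then 1 else 0) + (if k = b ∧ l = a then 1 else 0)) := by
  have hab := G.ne_of_adj hG
  rw [edgeVar_sdiff_edge G hab]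
  by_cases h1 : k = a ∧ l = b
  · obtain ⟨rfl, rfl⟩ := h1
    simp [edgeVar, hG, hab]
  by_cases h2 : k = b ∧ l = a
  · obtain ⟨rfl, rfl⟩ := h2
    simp [edgeVar, hG.symm, hab.symm]
  simp [h1, h2]

theorem numEdges_sub_sdiff_edge {G : SimpleGraph (Fin n)} {a b : Fin n} (hG : G.Adj a b) :
    numEdges G = numEdges (G \ SimpleGraph.edge a b) + 1 := by
  have h1 := two_mul_numEdges G
  have h2 := two_mul_numEdges (G \ SimpleGraph.edge a b)
  simp_rw [edgeVar_sub_sdiff_edge hG, Finset.sum_add_distrib] at h1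
  rw [← h2] at h1
  simp only [ite_and, Finset.sum_ite_eq', Finset.mem_univ, if_true, Finset.sum_ite_irrel,
    Finset.sum_const_zero] at h1
  linarith

/-- Six times the triangle count is the trace of the cubed adjacency matrix. Restoring the edge adds
`D = E_ab + E_ba`; since `D²` is diagonal, `D³` has trace zero and the adjacency matrix has zero
diagonal, only the term linear in `D` survives. -/
theorem numTriangles_sub_sdiff_edge {G : SimpleGraph (Fin n)} {a b : Fin n} (hG : G.Adj a b) :
    numTriangles G = numTriangles (G \ SimpleGraph.edge a b) + n * wedge G a b := by
  have hab := G.ne_of_adj hG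
  set Y := G \ SimpleGraph.edge a b with hY
  have key : ∀ K : SimpleGraph (Fin n), 6 * numTriangles K =
      Matrix.trace (Matrix.of (edgeVar K) * Matrix.of (edgeVar K) * Matrix.of (edgeVar K)) := by
    intro K
    rw [six_mul_numTriangles, Matrix.trace]
    simp only [Matrix.diag, Matrix.mul_apply, Matrix.of_apply, Finset.sum_mul]
    refine Finset.sum_congr rfl fun i _ => ?_
    rw [Finset.sum_comm]
    refine Finset.sum_congr rfl fun j _ => Finset.sum_congr rfl fun k _ => ?_
    rw [edgeVar_symm K j i]
  have hA : Matrix.of (edgeVar G) = Matrix.of (edgeVar Y) +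
      (Matrix.single a b 1 + Matrix.single b a 1) := by
    ext k l
    simp only [Matrix.of_apply, Matrix.add_apply, edgeVar_sub_sdiff_edge hG k l, Matrix.single_apply,
      eq_comm, hY]
  have h1 := key G
  rw [hA] at h1
  set A := Matrix.of (edgeVar Y)
  set D : Matrix (Fin n) (Fin n) ℝ := Matrix.single a b 1 + Matrix.single b a 1 with hD
  have e1 : Matrix.trace ((A + D) * (A + D) * (A + D)) =
      Matrix.trace (A * A * A) + 3 * Matrix.trace (A * A * D) + 3 * Matrix.trace (A * (D * D))
        + Matrix.trace (D * D * D) := by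
    have : (A + D) * (A + D) * (A + D) = A * A * A + (A * A * D + A * D * A + D * A * A)
      + (A * D * D + D * A * D + D * D * A) + D * D * D := by noncomm_ring
    rw [this]
    simp only [Matrix.trace_add]
    rw [Matrix.trace_mul_comm A (D * D), Matrix.trace_mul_cycle A D A,
      ← Matrix.trace_mul_cycle A A D, Matrix.trace_mul_cycle A D D, Matrix.trace_mul_cycle D A D]
    ring
  have e2 : D * D = Matrix.single a a 1 + Matrix.single b b 1 := by
    simp [hD, add_mul, mul_add, Matrix.single_mul_single_of_ne, hab, hab.symm, add_comm]
  have e3 : Matrix.trace (D * D * D) = 0 := by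
    rw [e2]
    simp [hD, add_mul, mul_add, Matrix.single_mul_single_of_ne, hab, hab.symm]
  have e4 : Matrix.trace (A * (D * D)) = 0 := by
    rw [e2, mul_add, Matrix.trace_add, Matrix.trace_mul_single, Matrix.trace_mul_single]
    simp [A]
  have e5 : Matrix.trace (A * A * D) = 2 * (n * wedge G a b) := by
    rw [hD, mul_add, Matrix.trace_add, Matrix.trace_mul_single, Matrix.trace_mul_single,
      ← wedge_sdiff_edge_self G hab, natCast_mul_wedge, two_mul]
    simp only [Matrix.mul_apply, A, Matrix.of_apply, one_smul,
      MulOpposite.op_one]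
    congr 1 <;> exact Finset.sum_congr rfl fun k _ => by
      rw [edgeVar_symm Y k] <;> ring
  rw [e1, e3, e4, e5, ← key Y] at h1
  linarith

theorem hamiltonian_sub_sdiff_edge (β h : ℝ) {G : SimpleGraph (Fin n)} {a b : Fin n}
    (hG : G.Adj a b) :
    hamiltonian β h G = hamiltonian β h (G \ SimpleGraph.edge a b) + (β * wedge G a b + h) := by
  have hn : (n : ℝ) ≠ 0 := by exact_mod_cast (Fin.pos a).ne'
  rw [hamiltonian, hamiltonian, numTriangles_sub_sdiff_edge hG, numEdges_sub_sdiff_edge hG]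
  field_simp
  ring

end Graph

/-! ### Gibbs expectations -/

section Gibbs
variable {n : ℕ} (β h : ℝ)

theorem partitionFn_pos (n : ℕ) : 0 < partitionFn n β h :=
  Finset.sum_pos (fun _ _ => Real.exp_pos _) Finset.univ_nonempty

theorem gibbsExp_eq (f : SimpleGraph (Fin n) → ℝ) :
    gibbsExp β h f = (∑ G, f G * Real.exp (hamiltonian β h G)) / partitionFn n β h := by
  rw [gibbsExp, Finset.sum_div]
  exact Finset.sum_congr rfl fun G _ => by ring

theorem gibbsExp_const (c : ℝ) : gibbsExp β h (fun _ : SimpleGraph (Fin n) => c) = c := by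
  rw [gibbsExp_eq, ← Finset.mul_sum]
  exact mul_div_cancel_right₀ _ (partitionFn_pos β h n).ne'

theorem gibbsExp_add (f g : SimpleGraph (Fin n) → ℝ) :
    gibbsExp β h (fun G => f G + g G) = gibbsExp β h f + gibbsExp β h g := by
  simp only [gibbsExp, ← Finset.sum_add_distrib, add_mul]

theorem gibbsExp_sub (f g : SimpleGraph (Fin n) → ℝ) :
    gibbsExp β h (fun G => f G - g G) = gibbsExp β h f - gibbsExp β h g := by
  simp only [gibbsExp, ← Finset.sum_sub_distrib, sub_mul]

theorem gibbsExp_const_mul (c : ℝ) (f : SimpleGraph (Fin n) → ℝ) :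
    gibbsExp β h (fun G => c * f G) = c * gibbsExp β h f := by
  simp only [gibbsExp, Finset.mul_sum, mul_assoc]

theorem gibbsExp_sum {ι : Type*} (s : Finset ι) (f : ι → SimpleGraph (Fin n) → ℝ) :
    gibbsExp β h (fun G => ∑ i ∈ s, f i G) = ∑ i ∈ s, gibbsExp β h (f i) := by
  simp only [gibbsExp, Finset.sum_mul]
  exact Finset.sum_comm

variable {β h}

theorem gibbsExp_mono {f g : SimpleGraph (Fin n) → ℝ} (hfg : ∀ G, f G ≤ g G) :
    gibbsExp β h f ≤ gibbsExp β h g :=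
  Finset.sum_le_sum fun G _ => mul_le_mul_of_nonneg_right (hfg G)
    (div_nonneg (Real.exp_pos _).le (partitionFn_pos β h n).le)

theorem gibbsExp_nonneg {f : SimpleGraph (Fin n) → ℝ} (hf : ∀ G, 0 ≤ f G) :
    0 ≤ gibbsExp β h f := by
  rw [← gibbsExp_const β h (n := n) 0]
  exact gibbsExp_mono hf

theorem gibbsExp_congr {f g : SimpleGraph (Fin n) → ℝ} (hfg : ∀ G, f G = g G) :
    gibbsExp β h f = gibbsExp β h g := by
  rw [funext hfg]

theorem gibbsExp_le_affine {f g : SimpleGraph (Fin n) → ℝ} {a b : ℝ}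
    (hfg : ∀ G, f G ≤ a * g G + b) : gibbsExp β h f ≤ a * gibbsExp β h g + b := by
  have := gibbsExp_mono (β := β) (h := h) hfg
  rwa [gibbsExp_add, gibbsExp_const, gibbsExp_const_mul] at this

variable (β h)

/-- The probability of `A` under the Gibbs measure. -/
def gibbsProb (A : Set (SimpleGraph (Fin n))) : ℝ := gibbsExp β h (A.indicator 1)

variable {β h}

theorem gibbsProb_nonneg (A : Set (SimpleGraph (Fin n))) : 0 ≤ gibbsProb β h A :=
  gibbsExp_nonneg fun G => Set.indicator_nonneg (fun _ _ => zero_le_one) G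

theorem gibbsProb_mono {A B : Set (SimpleGraph (Fin n))} (hAB : A ⊆ B) :
    gibbsProb β h A ≤ gibbsProb β h B :=
  gibbsExp_mono fun G => Set.indicator_le_indicator_of_subset hAB (fun _ => zero_le_one) G

theorem gibbsProb_union_le (A B : Set (SimpleGraph (Fin n))) :
    gibbsProb β h (A ∪ B) ≤ gibbsProb β h A + gibbsProb β h B := by
  rw [gibbsProb, gibbsProb, gibbsProb, ← gibbsExp_add]
  refine gibbsExp_mono fun G => ?_
  by_cases hA : G ∈ A <;> by_cases hB : G ∈ B <;> simp [hA, hB]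

theorem gibbsProb_compl (A : Set (SimpleGraph (Fin n))) :
    gibbsProb β h Aᶜ = 1 - gibbsProb β h A := by
  rw [gibbsProb, gibbsProb, ← gibbsExp_const β h (n := n) 1, ← gibbsExp_sub]
  refine gibbsExp_congr fun G => ?_
  by_cases hA : G ∈ A <;> simp [hA]

theorem gibbsProb_iUnion_le {ι : Type*} [Fintype ι] (A : ι → Set (SimpleGraph (Fin n))) :
    gibbsProb β h (⋃ i, A i) ≤ ∑ i, gibbsProb β h (A i) := by
  simp only [gibbsProb]
  rw [← gibbsExp_sum]
  refine gibbsExp_mono fun G => ?_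
  have h0 : ∀ i ∈ Finset.univ, (0 : ℝ) ≤ (A i).indicator 1 G := fun i _ =>
    Set.indicator_nonneg (fun _ _ => zero_le_one) G
  by_cases hG : G ∈ ⋃ i, A i
  · obtain ⟨i, hi⟩ := Set.mem_iUnion.1 hG
    rw [Set.indicator_of_mem hG]
    refine le_trans ?_ (Finset.single_le_sum h0 (Finset.mem_univ i))
    rw [Set.indicator_of_mem hi]
  · rw [Set.indicator_of_notMem hG]
    exact Finset.sum_nonneg h0

theorem gibbsProb_le_div {f : SimpleGraph (Fin n) → ℝ} (hf : ∀ G, 0 ≤ f G) {a : ℝ} (ha : 0 < a)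
    {A : Set (SimpleGraph (Fin n))} (hA : ∀ G ∈ A, a ≤ f G) :
    gibbsProb β h A ≤ gibbsExp β h f / a := by
  rw [div_eq_inv_mul, ← gibbsExp_const_mul]
  refine gibbsExp_mono fun G => ?_
  by_cases hG : G ∈ A
  · rw [Set.indicator_of_mem hG, Pi.one_apply, inv_mul_eq_div, one_le_div ha]
    exact hA G hG
  · rw [Set.indicator_of_notMem hG]
    exact mul_nonneg (by positivity) (hf G)

/-- Conditionally on the other edges, `ab` is present with probability `φ(L_ab)`. -/
theorem gibbsExp_edge_sub_phi_mul {a b : Fin n} (hab : a ≠ b) (g : SimpleGraph (Fin n) → ℝ) :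
    gibbsExp β h (fun G => (edgeVar G a b - phi β h (wedge G a b)) *
      g (G \ SimpleGraph.edge a b)) = 0 := by
  set e := SimpleGraph.edge a b with he
  set f : SimpleGraph (Fin n) → ℝ := fun G =>
    (edgeVar G a b - phi β h (wedge G a b)) * g (G \ e) * Real.exp (hamiltonian β h G) with hf
  -- Graphs are paired by toggling the edge `ab`. The wedge density at `ab` and the argument of `g`
  -- do not see this edge, and the weights differ by `exp(βL+h)`, the odds of `φ(L)`, so the two
  -- terms of each pair cancel.
  have hinv : Function.Involutive fun G : SimpleGraph (Fin n) => symmDiff G e :=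
    fun G => symmDiff_symmDiff_cancel_right e G
  have hadj : ∀ G : SimpleGraph (Fin n), G.Adj a b → f G + f (symmDiff G e) = 0 := by
    intro G hG
    have heG : e ≤ G := by
      intro x y hxy
      rw [he, SimpleGraph.edge_adj] at hxy
      obtain ⟨⟨rfl, rfl⟩ | ⟨rfl, rfl⟩, -⟩ := hxy
      · exact hG
      · exact hG.symm
    have h1 : symmDiff G e = G \ e := symmDiff_of_ge heG
    have h2 : edgeVar G a b = 1 := by simp [edgeVar, hG]
    have h3 : edgeVar (G \ e) a b = 0 := by rw [he, edgeVar_sdiff_edge G hab]; simp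
    simp only [hf]
    rw [h1, sdiff_idem, h2, h3, wedge_sdiff_edge_self G hab, hamiltonian_sub_sdiff_edge β h hG,
      Real.exp_add]
    have h4 : (1 - phi β h (wedge G a b)) * Real.exp (β * wedge G a b + h)
        = phi β h (wedge G a b) := by
      rw [one_sub_phi, phi]; field_simp
    linear_combination (g (G \ e) * Real.exp (hamiltonian β h (G \ e))) * h4
  have hall : ∀ G : SimpleGraph (Fin n), f G + f (symmDiff G e) = 0 := by
    intro G
    by_cases hG : G.Adj a b
    · exact hadj G hG
    · have : (symmDiff G e).Adj a b := by
        rw [symmDiff_def, SimpleGraph.sup_adj]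
        right
        rw [SimpleGraph.sdiff_adj]
        exact ⟨by rw [he, SimpleGraph.edge_adj]; exact ⟨Or.inl ⟨rfl, rfl⟩, hab⟩, hG⟩
      have h2 := hadj _ this
      rw [symmDiff_symmDiff_cancel_right] at h2
      rw [add_comm]; exact h2
  have hsum : ∑ G, f G = ∑ G, f (symmDiff G e) := (Equiv.sum_comp hinv.toPerm f).symm
  have h0 : ∑ G, f G + ∑ G, f (symmDiff G e) = 0 := by
    rw [← Finset.sum_add_distrib]
    exact Finset.sum_eq_zero fun G _ => hall G
  rw [gibbsExp_eq]
  change (∑ G, f G) / _ = 0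
  rw [← hsum] at h0
  rw [show ∑ G, f G = 0 by linarith, zero_div]

end Gibbs

/-! ### Sixth moment bound -/

section Lipschitz
variable {n : ℕ}

theorem abs_edgeVar_sub_sdiff_edge_le (G : SimpleGraph (Fin n)) {a b : Fin n} (hab : a ≠ b)
    (k l : Fin n) :
    |edgeVar G k l - edgeVar (G \ SimpleGraph.edge a b) k l| ≤
      if (k = a ∧ l = b) ∨ (k = b ∧ l = a) then 1 else 0 := by
  rw [edgeVar_sdiff_edge G hab]
  split_ifs
  · rw [sub_zero, abs_of_nonneg (edgeVar_nonneg _ _ _)]; exact edgeVar_le_one _ _ _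
  · simp

/-- Only the summands `k = a` and `k = b` can change; the constant is crude but only the order `1/n`
matters. -/
theorem abs_wedge_sub_sdiff_edge_le (G : SimpleGraph (Fin n)) {a b : Fin n} (hab : a ≠ b)
    (i j : Fin n) :
    |wedge G i j - wedge (G \ SimpleGraph.edge a b) i j| ≤ 4 / n := by
  have hn : (0 : ℝ) < n := by exact_mod_cast Fin.pos i
  rw [wedge_eq, wedge_eq, ← mul_sub, ← Finset.sum_sub_distrib, abs_mul,
    abs_of_nonneg (by positivity), one_div, inv_mul_eq_div]
  refine div_le_div_of_nonneg_right ?_ hn.le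
  refine (Finset.abs_sum_le_sum_abs _ _).trans ?_
  have hterm : ∀ k, |edgeVar G i k * edgeVar G j k -
      edgeVar (G \ SimpleGraph.edge a b) i k * edgeVar (G \ SimpleGraph.edge a b) j k| ≤
      2 * ((if k = a then 1 else 0) + (if k = b then 1 else 0)) := by
    intro k
    have h1 := abs_edgeVar_sub_sdiff_edge_le G hab i k
    have h2 := abs_edgeVar_sub_sdiff_edge_le G hab j k
    set Y := G \ SimpleGraph.edge a b
    have h3 : ∀ x : Fin n, (if (x = a ∧ k = b) ∨ (x = b ∧ k = a) then (1 : ℝ) else 0) ≤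
        (if k = a then 1 else 0) + (if k = b then 1 else 0) := by
      intro x; split_ifs <;> simp_all
    have h4 : edgeVar G i k * edgeVar G j k - edgeVar Y i k * edgeVar Y j k =
      (edgeVar G i k - edgeVar Y i k) * edgeVar G j k +
        edgeVar Y i k * (edgeVar G j k - edgeVar Y j k) := by ring
    rw [h4]
    refine (abs_add_le _ _).trans ?_
    rw [abs_mul, abs_mul, abs_of_nonneg (edgeVar_nonneg G j k), abs_of_nonneg (edgeVar_nonneg Y i k)]
    have h5 := mul_le_mul_of_nonneg_left (edgeVar_le_one G j k) (abs_nonneg (edgeVar G i k - edgeVar Y i k))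
    have h6 := mul_le_mul_of_nonneg_right (edgeVar_le_one Y i k) (abs_nonneg (edgeVar G j k - edgeVar Y j k))
    have := h3 i
    have := h3 j
    linarith
  refine (Finset.sum_le_sum fun k _ => hterm k).trans ?_
  rw [← Finset.mul_sum, Finset.sum_add_distrib]
  simp
  norm_num

end Lipschitz

theorem abs_phi_sub_phi_le {β : ℝ} (hβ : 0 ≤ β) (h x y : ℝ) :
    |phi β h x - phi β h y| ≤ β * |x - y| := by
  have := Convex.norm_image_sub_le_of_norm_hasDerivWithin_le (f := phi β h) (s := Set.univ)
    (C := β) (x := y) (y := x) (fun z _ => (hasDerivAt_phi β h z).hasDerivWithinAt) (fun z _ => by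
      have h1 := phi_pos β h z
      have h2 := phi_lt_one β h z
      rw [Real.norm_eq_abs, abs_of_nonneg (by
        have := sub_pos.2 h2; positivity)]
      exact mul_le_of_le_one_right hβ (by nlinarith)) convex_univ (Set.mem_univ _) (Set.mem_univ _)
  simpa [Real.norm_eq_abs] using this

theorem abs_pow_five_sub_le {x y d : ℝ} (hxy : |x - y| ≤ d) :
    |x ^ 5 - y ^ 5| ≤ 40 * d * (x ^ 4 + d ^ 4) := by
  have hd : 0 ≤ d := (abs_nonneg _).trans hxy
  have hy : |y| ≤ |x| + d := by
    have := abs_sub_abs_le_abs_sub y x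
    rw [abs_sub_comm] at this
    linarith
  set M := |x| + d with hM
  have hM0 : 0 ≤ M := by positivity
  have hx : |x| ≤ M := by linarith
  have h1 : x ^ 5 - y ^ 5 = (x - y) * (x ^ 4 + x ^ 3 * y + x ^ 2 * y ^ 2 + x * y ^ 3 + y ^ 4) := by
    ring
  have h2 : |x ^ 4 + x ^ 3 * y + x ^ 2 * y ^ 2 + x * y ^ 3 + y ^ 4| ≤ 5 * M ^ 4 := by
    have t : ∀ a b : ℕ, a + b = 4 → |x ^ a * y ^ b| ≤ M ^ 4 := by
      intro a b hab
      rw [abs_mul, abs_pow, abs_pow, ← hab, pow_add]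
      gcongr
    have t4 := t 4 0 rfl
    have t3 := t 3 1 rfl
    have t2 := t 2 2 rfl
    have t1 := t 1 3 rfl
    have t0 := t 0 4 rfl
    simp only [pow_zero, mul_one, pow_one, one_mul] at t4 t3 t1 t0
    rw [abs_le] at *
    constructor <;> linarith [t4.1, t4.2, t3.1, t3.2, t2.1, t2.2, t1.1, t1.2, t0.1, t0.2]
  have h3 : M ^ 4 ≤ 8 * (x ^ 4 + d ^ 4) := by
    have e1 : M ^ 2 ≤ 2 * (x ^ 2 + d ^ 2) := by
      rw [hM, ← sq_abs x]; nlinarith [sq_nonneg (|x| - d)]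
    have e2 : M ^ 4 ≤ (2 * (x ^ 2 + d ^ 2)) ^ 2 := by
      rw [show M ^ 4 = (M ^ 2) ^ 2 by ring]
      exact pow_le_pow_left₀ (by positivity) e1 2
    nlinarith [sq_nonneg (x ^ 2 - d ^ 2)]
  rw [h1, abs_mul]
  calc |x - y| * |x ^ 4 + x ^ 3 * y + x ^ 2 * y ^ 2 + x * y ^ 3 + y ^ 4|
      ≤ d * (5 * M ^ 4) := by gcongr
    _ ≤ d * (5 * (8 * (x ^ 4 + d ^ 4))) := by gcongr
    _ = _ := by ring

/-- A form of Young's inequality; the coefficient 1/2 lets the sixth moment be absorbed into the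
left side of its own estimate. -/
theorem mul_pow_four_le {A m x : ℝ} (hA : 0 ≤ A) (hm : 0 ≤ m) :
    A * m * x ^ 4 ≤ x ^ 6 / 2 + 4 * A ^ 3 * m ^ 3 := by
  have hx : 0 ≤ x ^ 2 := sq_nonneg x
  rw [show x ^ 4 = (x ^ 2) ^ 2 by ring, show x ^ 6 = (x ^ 2) ^ 3 by ring]
  generalize x ^ 2 = a at hx
  rcases le_total a (2 * (A * m)) with hc | hc
  · have h1 : a ^ 2 ≤ (2 * (A * m)) ^ 2 := pow_le_pow_left₀ hx hc 2
    have h2 := mul_le_mul_of_nonneg_left h1 (mul_nonneg hA hm)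
    have h3 : 0 ≤ a ^ 3 := by positivity
    nlinarith
  · have h2 := mul_le_mul_of_nonneg_right hc (sq_nonneg a)
    have h3 : 0 ≤ 4 * A ^ 3 * m ^ 3 := by positivity
    nlinarith

theorem abs_edgeVar_sub_phi_le {n : ℕ} (β h : ℝ) (G : SimpleGraph (Fin n)) (i j : Fin n) (x : ℝ) :
    |edgeVar G i j - phi β h x| ≤ 1 := by
  rw [abs_le]
  have := edgeVar_nonneg G i j
  have := edgeVar_le_one G i j
  have := phi_pos β h x
  have := phi_lt_one β h x
  constructor <;> linarith

/-- The weighted row fluctuation `∑_{k ∈ S} (X_ik - φ(L_ik)) W_k`. -/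
def rowFluct {n : ℕ} (β h : ℝ) (i : Fin n) (S : Finset (Fin n))
    (W : Fin n → SimpleGraph (Fin n) → ℝ) (G : SimpleGraph (Fin n)) : ℝ :=
  ∑ k ∈ S, (edgeVar G i k - phi β h (wedge G i k)) * W k G

theorem abs_rowFluct_le {n : ℕ} {β h : ℝ} {i : Fin n} {S : Finset (Fin n)}
    {W : Fin n → SimpleGraph (Fin n) → ℝ} (hW : ∀ k G, |W k G| ≤ 1) (G : SimpleGraph (Fin n)) :
    |rowFluct β h i S W G| ≤ n := by
  refine (Finset.abs_sum_le_sum_abs _ _).trans ?_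
  have : ∀ k ∈ S, |(edgeVar G i k - phi β h (wedge G i k)) * W k G| ≤ 1 := fun k _ => by
    rw [abs_mul]
    exact mul_le_one₀ (abs_edgeVar_sub_phi_le _ _ _ _ _ _) (abs_nonneg _) (hW k G)
  refine (Finset.sum_le_sum this).trans ?_
  simp only [Finset.sum_const, nsmul_eq_mul, mul_one]
  exact_mod_cast (Finset.card_le_univ S).trans (Fintype.card_fin n).le

/-- Deleting one edge of row `i` moves that edge variable by at most 1, while each of the at most
`n` terms `φ(L_ik)` moves by at most `4β/n` and each weight by at most `c/n`: the total is `O(1)`.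
-/
theorem abs_rowFluct_sub_le {n : ℕ} {β h c : ℝ} (hβ : 0 ≤ β) (hc : 0 ≤ c) {i : Fin n}
    {S : Finset (Fin n)} (hi : i ∉ S) {W : Fin n → SimpleGraph (Fin n) → ℝ}
    (hW : ∀ k G, |W k G| ≤ 1)
    (hW' : ∀ k ∈ S, ∀ l ∈ S, ∀ G, |W k G - W k (G \ SimpleGraph.edge i l)| ≤ c / n)
    {l : Fin n} (hl : l ∈ S) (G : SimpleGraph (Fin n)) :
    |rowFluct β h i S W G - rowFluct β h i S W (G \ SimpleGraph.edge i l)| ≤ 1 + 4 * β + c := by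
  have hn : (0 : ℝ) < n := by exact_mod_cast Fin.pos i
  have hil : i ≠ l := fun e => hi (e ▸ hl)
  rw [rowFluct, rowFluct, ← Finset.sum_sub_distrib]
  set Y := G \ SimpleGraph.edge i l with hY
  refine (Finset.abs_sum_le_sum_abs _ _).trans ?_
  have hterm : ∀ k ∈ S, |(edgeVar G i k - phi β h (wedge G i k)) * W k G -
      (edgeVar Y i k - phi β h (wedge Y i k)) * W k Y| ≤
      (if k = l then 1 else 0) + (4 * β + c) / n := by
    intro k hk
    have hki : k ≠ i := fun e => hi (e ▸ hk)
    have e1 : (edgeVar G i k - phi β h (wedge G i k)) * W k G -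
      (edgeVar Y i k - phi β h (wedge Y i k)) * W k Y =
      ((edgeVar G i k - edgeVar Y i k) - (phi β h (wedge G i k) - phi β h (wedge Y i k))) * W k G +
        (edgeVar Y i k - phi β h (wedge Y i k)) * (W k G - W k Y) := by ring
    have e2 := abs_edgeVar_sub_sdiff_edge_le G hil i k
    simp only [hil, hki, and_false, or_false, true_and] at e2
    have e3 : |phi β h (wedge G i k) - phi β h (wedge Y i k)| ≤ β * (4 / n) :=
      (abs_phi_sub_phi_le hβ h _ _).trans
        (mul_le_mul_of_nonneg_left (abs_wedge_sub_sdiff_edge_le G hil i k) hβ)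
    rw [e1]
    refine (abs_add_le _ _).trans ?_
    rw [abs_mul, abs_mul]
    have e4 := mul_le_mul (abs_sub (edgeVar G i k - edgeVar Y i k)
      (phi β h (wedge G i k) - phi β h (wedge Y i k))) (hW k G) (abs_nonneg _) (by positivity)
    have e5 := mul_le_mul (abs_edgeVar_sub_phi_le β h Y i k (wedge Y i k)) (hW' k hk l hl G)
      (abs_nonneg _) zero_le_one
    calc _ ≤ _ := add_le_add e4 e5
      _ ≤ ((if k = l then 1 else 0) + β * (4 / n)) * 1 + 1 * (c / n) := by gcongr
      _ = _ := by field_simp; ring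
  refine (Finset.sum_le_sum hterm).trans ?_
  rw [Finset.sum_add_distrib, Finset.sum_ite_eq' S l, if_pos hl, Finset.sum_const, nsmul_eq_mul]
  have hcard : (S.card : ℝ) ≤ n := by
    exact_mod_cast (Finset.card_le_univ S).trans (Fintype.card_fin n).le
  have : (S.card : ℝ) * ((4 * β + c) / n) ≤ n * ((4 * β + c) / n) := by gcongr
  rw [mul_div_cancel₀ _ hn.ne'] at this
  linarith

/-- Sixth moment bound for weighted row fluctuations, by exchangeable-pair resampling. -/
theorem exists_gibbsExp_rowFluct_pow_six_le {β : ℝ} (hβ : 0 ≤ β) (h : ℝ) {c : ℝ} (hc : 0 ≤ c) :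
    ∃ C : ℝ, 0 ≤ C ∧ ∀ (n : ℕ) (i : Fin n) (S : Finset (Fin n)), i ∉ S →
      ∀ W : Fin n → SimpleGraph (Fin n) → ℝ, (∀ k G, |W k G| ≤ 1) →
      (∀ k ∈ S, ∀ l ∈ S, ∀ G, |W k G - W k (G \ SimpleGraph.edge i l)| ≤ c / n) →
      gibbsExp β h (fun G => rowFluct β h i S W G ^ 6) ≤ C * n ^ 3 := by
  set d := 1 + 4 * β + c with hd
  have hd0 : 0 ≤ d := by positivity
  set A := c + 40 * d with hA
  have hA0 : 0 ≤ A := by positivity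
  refine ⟨8 * A ^ 3 + 80 * d ^ 5, by positivity, fun n i S hi W hW hW' => ?_⟩
  have hn : (1 : ℝ) ≤ n := by exact_mod_cast Fin.pos i
  have hn0 : (0 : ℝ) < n := by linarith
  set F := rowFluct β h i S W with hF
  have hFn : ∀ G, |F G| ≤ n := abs_rowFluct_le hW
  have hterm : ∀ k ∈ S, gibbsExp β h (fun G =>
      (edgeVar G i k - phi β h (wedge G i k)) * (W k G * F G ^ 5)) ≤
      gibbsExp β h (fun G => A * F G ^ 4 + 40 * d ^ 5) := by
    intro k hk
    have hik : i ≠ k := fun e => hi (e ▸ hk)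
    -- One factor of `F⁶` is expanded. Evaluating `W_k F⁵` after deletion of the edge `ik` gives
    -- mean zero, so it may be subtracted; what remains is a discrete derivative, of order `F⁴`.
    have h0 := gibbsExp_edge_sub_phi_mul (β := β) (h := h) hik (fun G => W k G * F G ^ 5)
    rw [← sub_zero (gibbsExp β h _), ← h0, ← gibbsExp_sub]
    refine gibbsExp_mono fun G => ?_
    set Y := G \ SimpleGraph.edge i k with hY
    rw [← mul_sub]
    refine (le_abs_self _).trans ?_
    rw [abs_mul]
    refine (mul_le_of_le_one_left (abs_nonneg _) (abs_edgeVar_sub_phi_le _ _ _ _ _ _)).trans ?_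
    have e1 : W k G * F G ^ 5 - W k Y * F Y ^ 5 =
      (W k G - W k Y) * F G ^ 5 + W k Y * (F G ^ 5 - F Y ^ 5) := by ring
    have e2 := abs_pow_five_sub_le (abs_rowFluct_sub_le (h := h) hβ hc hi hW hW' hk G)
    rw [e1]
    refine (abs_add_le _ _).trans ?_
    rw [abs_mul, abs_mul]
    -- The trivial bound `|F| ≤ n` pays for the gain `c/n` from the weights.
    have e3 : |W k G - W k Y| * |F G ^ 5| ≤ c * F G ^ 4 := by
      have : |F G ^ 5| ≤ n * F G ^ 4 := by
        rw [pow_succ', abs_mul, abs_of_nonneg (by positivity : 0 ≤ F G ^ 4)]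
        exact mul_le_mul_of_nonneg_right (hFn G) (by positivity)
      calc _ ≤ c / n * (n * F G ^ 4) :=
            mul_le_mul (hW' k hk k hk G) this (abs_nonneg _) (by positivity)
        _ = _ := by field_simp
    have e4 : |W k Y| * |F G ^ 5 - F Y ^ 5| ≤ 40 * d * (F G ^ 4 + d ^ 4) :=
      (mul_le_of_le_one_left (abs_nonneg _) (hW k Y)).trans e2
    refine (add_le_add e3 e4).trans (le_of_eq ?_)
    rw [hA]; ring
  have hsum : gibbsExp β h (fun G => F G ^ 6) =
      ∑ k ∈ S, gibbsExp β h (fun G =>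
        (edgeVar G i k - phi β h (wedge G i k)) * (W k G * F G ^ 5)) := by
    rw [← gibbsExp_sum]
    refine gibbsExp_congr fun G => ?_
    rw [pow_succ' (F G) 5]
    nth_rewrite 1 [hF]
    rw [rowFluct, Finset.sum_mul]
    exact Finset.sum_congr rfl fun k _ => by ring
  have hpos : 0 ≤ gibbsExp β h (fun G => A * F G ^ 4 + 40 * d ^ 5) :=
    gibbsExp_nonneg fun G => by positivity
  have hcard : (S.card : ℝ) ≤ n := by
    exact_mod_cast (Finset.card_le_univ S).trans (Fintype.card_fin n).le
  have h1 : gibbsExp β h (fun G => F G ^ 6) ≤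
      n * gibbsExp β h (fun G => A * F G ^ 4 + 40 * d ^ 5) := by
    rw [hsum]
    refine (Finset.sum_le_sum hterm).trans ?_
    rw [Finset.sum_const, nsmul_eq_mul]
    exact mul_le_mul_of_nonneg_right hcard hpos
  -- Half of the sixth moment goes back to the left side, which doubles the remaining `O(n³)`.
  have h2 : n * gibbsExp β h (fun G => A * F G ^ 4 + 40 * d ^ 5) ≤
      (1 / 2) * gibbsExp β h (fun G => F G ^ 6) + (4 * A ^ 3 * n ^ 3 + 40 * d ^ 5 * n) := by
    rw [← gibbsExp_const_mul]
    refine gibbsExp_le_affine fun G => ?_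
    have := mul_pow_four_le (x := F G) hA0 hn0.le
    linarith
  have h3 : (n : ℝ) ≤ n ^ 3 := by
    have := pow_le_pow_right₀ hn (show 1 ≤ 3 by norm_num)
    simpa using this
  have h4 : 40 * d ^ 5 * n ≤ 40 * d ^ 5 * n ^ 3 := by gcongr
  linarith

theorem abs_le_one_add_pow_six (x : ℝ) : |x| ≤ 1 + x ^ 6 := by
  rcases le_total |x| 1 with hx | hx
  · have : 0 ≤ x ^ 6 := by positivity
    linarith
  · have h1 : |x| ≤ |x| ^ 6 := by simpa using pow_le_pow_right₀ hx (show 1 ≤ 6 by norm_num)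
    have h2 : |x| ^ 6 = x ^ 6 := by rw [← abs_pow, abs_of_nonneg (by positivity)]
    linarith

/-- Rescaling by `√n` and using `|x| ≤ 1 + x⁶` replaces Hölder's inequality. -/
theorem gibbsExp_abs_le_of_pow_six {n : ℕ} (hn : 0 < n) {β h C : ℝ}
    {f : SimpleGraph (Fin n) → ℝ}
    (hf : gibbsExp β h (fun G => f G ^ 6) ≤ C * n ^ 3) :
    gibbsExp β h (fun G => |f G|) ≤ (1 + C) * Real.sqrt n := by
  have hn' : (0 : ℝ) < n := by exact_mod_cast hn
  have hs : 0 < Real.sqrt n := Real.sqrt_pos.2 hn'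
  have hs6 : Real.sqrt n ^ 6 = (n : ℝ) ^ 3 := by
    rw [show 6 = 2 * 3 by norm_num, pow_mul, Real.sq_sqrt hn'.le]
  have h1 : gibbsExp β h (fun G => |f G|) ≤
      Real.sqrt n * (1 + ((n : ℝ) ^ 3)⁻¹ * gibbsExp β h (fun G => f G ^ 6)) := by
    rw [← gibbsExp_const_mul, ← gibbsExp_const β h (n := n) 1, ← gibbsExp_add,
      ← gibbsExp_const_mul]
    refine gibbsExp_mono fun G => ?_
    have := abs_le_one_add_pow_six (f G / Real.sqrt n)
    rw [div_pow, hs6, abs_div, abs_of_pos hs, div_le_iff₀ hs] at this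
    refine this.trans (le_of_eq ?_)
    ring
  refine h1.trans ?_
  rw [mul_comm]
  refine mul_le_mul_of_nonneg_right ?_ hs.le
  have : ((n : ℝ) ^ 3)⁻¹ * gibbsExp β h (fun G => f G ^ 6) ≤ ((n : ℝ) ^ 3)⁻¹ * (C * n ^ 3) :=
    mul_le_mul_of_nonneg_left hf (by positivity)
  have e : ((n : ℝ) ^ 3)⁻¹ * (C * n ^ 3) = C := by field_simp
  linarith

/-! ### Fluctuations of wedges, edges and triangles -/

section Fluct
variable {n : ℕ} (β h : ℝ)

/-- The defect of `L_ij` in the mean-field equation `L_ij ≈ n⁻¹ ∑_k φ(L_ik) φ(L_jk)`. -/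
def wedgeFluct (G : SimpleGraph (Fin n)) (i j : Fin n) : ℝ :=
  wedge G i j - (1 / (n : ℝ)) *
    ∑ k ∈ Finset.univ \ {i, j}, phi β h (wedge G i k) * phi β h (wedge G j k)

/-- The edge fluctuation `∑_{i ≠ k} (X_ik - φ(L_ik))`. -/
def edgeFluct (G : SimpleGraph (Fin n)) : ℝ :=
  ∑ i, ∑ k ∈ Finset.univ \ {i}, (edgeVar G i k - phi β h (wedge G i k))

/-- The total off-diagonal deviation `∑_{i ≠ k} |L_ik - w|`. -/
def wedgeDev (w : ℝ) (G : SimpleGraph (Fin n)) : ℝ :=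
  ∑ i, ∑ k ∈ Finset.univ \ {i}, |wedge G i k - w|

variable {β h}

theorem wedgeDev_nonneg (w : ℝ) (G : SimpleGraph (Fin n)) : 0 ≤ wedgeDev w G :=
  Finset.sum_nonneg fun _ _ => Finset.sum_nonneg fun _ _ => abs_nonneg _

/-- Telescoping `X_ik X_jk - φ_ik φ_jk = (X_ik - φ_ik) X_jk + φ_ik (X_jk - φ_jk)` leaves two row
fluctuations, whose weights are insensitive to edges of the row being resampled. -/
theorem natCast_mul_wedgeFluct {i j : Fin n} (G : SimpleGraph (Fin n)) :
    n * wedgeFluct β h G i j =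
      rowFluct β h i (Finset.univ \ {i, j}) (fun k G => edgeVar G j k) G +
      rowFluct β h j (Finset.univ \ {i, j}) (fun k G => phi β h (wedge G i k)) G := by
  have hn : (n : ℝ) ≠ 0 := by exact_mod_cast (Fin.pos i).ne'
  rw [wedgeFluct, wedge, ← mul_sub, ← mul_assoc, mul_one_div_cancel hn, one_mul, rowFluct, rowFluct,
    ← Finset.sum_sub_distrib, ← Finset.sum_add_distrib]
  exact Finset.sum_congr rfl fun k _ => by ring

/-- The first moments give the rate `n^(-1/2)`. The sixth moment serves a union bound over the `n²`
pairs, which leaves `O(1/n)`; a fourth moment of order `n⁻²` would leave only `O(1)`. -/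
theorem exists_fluct_bounds {β : ℝ} (hβ : 0 ≤ β) (h : ℝ) :
    ∃ C : ℝ, 0 ≤ C ∧ ∀ n : ℕ, 0 < n →
      (∀ i j : Fin n, i ≠ j →
        gibbsExp β h (fun G => wedgeFluct β h G i j ^ 6) ≤ C / n ^ 3 ∧
        gibbsExp β h (fun G => |wedgeFluct β h G i j|) ≤ C / Real.sqrt n) ∧
      gibbsExp β h (fun G : SimpleGraph (Fin n) => |edgeFluct β h G|) ≤ C * (n * Real.sqrt n) := by
  obtain ⟨C, hC, H⟩ := exists_gibbsExp_rowFluct_pow_six_le hβ h (c := 4 * β) (by positivity)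
  refine ⟨1 + 64 * C, by positivity, fun n hn => ⟨fun i j hij => ?_, ?_⟩⟩
  · have hn' : (0 : ℝ) < n := by exact_mod_cast hn
    have h6 : gibbsExp β h (fun G => (n * wedgeFluct β h G i j) ^ 6) ≤ 64 * C * n ^ 3 := by
      have a1 := H n i (Finset.univ \ {i, j}) (by simp) (fun k G => edgeVar G j k)
        (fun k G => by
          rw [abs_of_nonneg (edgeVar_nonneg _ _ _)]; exact edgeVar_le_one _ _ _)
        (fun k hk l hl G => by
          have hl' : l ≠ i ∧ l ≠ j := by simpa using hl
          refine (abs_edgeVar_sub_sdiff_edge_le G hl'.1.symm j k).trans ?_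
          rw [if_neg]
          · positivity
          · rintro (⟨e, -⟩ | ⟨e, -⟩)
            · exact hij e.symm
            · exact hl'.2 e.symm)
      have a2 := H n j (Finset.univ \ {i, j}) (by simp) (fun k G => phi β h (wedge G i k))
        (fun k G => by
          rw [abs_of_pos (phi_pos _ _ _)]; exact (phi_lt_one _ _ _).le)
        (fun k hk l hl G => by
          have hl' : l ≠ i ∧ l ≠ j := by simpa using hl
          refine (abs_phi_sub_phi_le hβ h _ _).trans ?_
          refine (mul_le_mul_of_nonneg_left
            (abs_wedge_sub_sdiff_edge_le G hl'.2.symm i k) hβ).trans (le_of_eq ?_)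
          ring)
      calc gibbsExp β h (fun G => (n * wedgeFluct β h G i j) ^ 6)
          ≤ gibbsExp β h (fun G => 2 ^ 5 *
            (rowFluct β h i (Finset.univ \ {i, j}) (fun k G => edgeVar G j k) G ^ 6 +
            rowFluct β h j (Finset.univ \ {i, j}) (fun k G => phi β h (wedge G i k)) G ^ 6)) := by
            refine gibbsExp_mono fun G => ?_
            rw [natCast_mul_wedgeFluct]
            exact Even.add_pow_le (by decide)
        _ ≤ 2 ^ 5 * (C * n ^ 3 + C * n ^ 3) := by
            rw [gibbsExp_const_mul, gibbsExp_add]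
            gcongr
        _ = _ := by ring
    have h1 := gibbsExp_abs_le_of_pow_six hn h6
    simp only [mul_pow, abs_mul, gibbsExp_const_mul, abs_of_pos hn'] at h6 h1
    constructor
    · rw [le_div_iff₀ (by positivity)]
      refine le_of_mul_le_mul_left ?_ (show (0 : ℝ) < n ^ 3 by positivity)
      have : (0 : ℝ) ≤ n ^ 3 := by positivity
      calc _ = (n : ℝ) ^ 6 * gibbsExp β h (fun G => wedgeFluct β h G i j ^ 6) := by ring
        _ ≤ 64 * C * n ^ 3 := h6
        _ ≤ _ := by nlinarith
    · have hs : 0 < Real.sqrt n := Real.sqrt_pos.2 hn'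
      rw [le_div_iff₀ hs]
      refine le_of_mul_le_mul_left ?_ hs
      calc _ = (Real.sqrt n * Real.sqrt n) * gibbsExp β h (fun G => |wedgeFluct β h G i j|) := by
            ring
        _ = n * gibbsExp β h (fun G => |wedgeFluct β h G i j|) := by
            rw [Real.mul_self_sqrt hn'.le]
        _ ≤ _ := h1.trans (le_of_eq (mul_comm _ _))
  · have hrow : ∀ i : Fin n, gibbsExp β h (fun G =>
        |rowFluct β h i (Finset.univ \ {i}) (fun _ _ => 1) G|) ≤ (1 + C) * Real.sqrt n := fun i =>
      gibbsExp_abs_le_of_pow_six hn (H n i (Finset.univ \ {i}) (by simp) (fun _ _ => 1)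
        (fun _ _ => by simp) (fun _ _ _ _ _ => by simp; positivity))
    calc gibbsExp β h (fun G : SimpleGraph (Fin n) => |edgeFluct β h G|)
        ≤ gibbsExp β h (fun G => ∑ i, |rowFluct β h i (Finset.univ \ {i}) (fun _ _ => 1) G|) := by
          refine gibbsExp_mono fun G => ?_
          simp only [edgeFluct, rowFluct, mul_one]
          exact Finset.abs_sum_le_sum_abs _ _
      _ ≤ ∑ _i : Fin n, (1 + C) * Real.sqrt n := by
          rw [gibbsExp_sum]
          exact Finset.sum_le_sum fun i _ => hrow i
      _ = (1 + C) * (n * Real.sqrt n) := by simp; ring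
      _ ≤ _ := by
          have : (0 : ℝ) ≤ n * Real.sqrt n := by positivity
          nlinarith

theorem sum_offDiag_edgeVar (G : SimpleGraph (Fin n)) (f : Fin n → Fin n → ℝ) :
    ∑ i, ∑ k, edgeVar G i k * f i k = ∑ i, ∑ k ∈ Finset.univ \ {i}, edgeVar G i k * f i k := by
  refine Finset.sum_congr rfl fun i _ => ?_
  symm
  refine Finset.sum_subset (Finset.subset_univ _) fun k _ hk => ?_
  have : k = i := by simpa using hk
  subst this; simp

theorem sum_offDiag_const (c : ℝ) :
    ∑ i : Fin n, ∑ _k ∈ Finset.univ \ {i}, c = (n * (n - 1) : ℝ) * c := by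
  rcases Nat.eq_zero_or_pos n with rfl | hn
  · simp
  simp only [Finset.sum_const, ← Finset.compl_eq_univ_sdiff, Finset.card_compl,
    Finset.card_singleton, Fintype.card_fin, nsmul_eq_mul, Finset.card_univ]
  rw [Nat.cast_sub hn]; push_cast; ring

theorem abs_two_mul_numEdges_sub_le (hβ : 0 ≤ β) (w : ℝ) (G : SimpleGraph (Fin n)) :
    |2 * numEdges G - n ^ 2 * phi β h w| ≤ |edgeFluct β h G| + β * wedgeDev w G + n := by
  have h1 : 2 * numEdges G - n ^ 2 * phi β h w = edgeFluct β h G +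
      ∑ i : Fin n, ∑ k ∈ Finset.univ \ {i}, (phi β h (wedge G i k) - phi β h w)
        - n * phi β h w := by
    have e1 := sum_offDiag_edgeVar G (fun _ _ => 1)
    have e2 := sum_offDiag_const (n := n) (phi β h w)
    simp only [mul_one] at e1
    rw [two_mul_numEdges, e1, edgeFluct]
    simp only [Finset.sum_sub_distrib]
    rw [e2]
    ring
  have h2 : |∑ i : Fin n, ∑ k ∈ Finset.univ \ {i}, (phi β h (wedge G i k) - phi β h w)| ≤
      β * wedgeDev w G := by
    rw [wedgeDev, Finset.mul_sum]
    refine (Finset.abs_sum_le_sum_abs _ _).trans (Finset.sum_le_sum fun i _ => ?_)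
    rw [Finset.mul_sum]
    exact (Finset.abs_sum_le_sum_abs _ _).trans
      (Finset.sum_le_sum fun k _ => abs_phi_sub_phi_le hβ h _ _)
  have h3 : |n * phi β h w| ≤ n := by
    rw [abs_of_nonneg (by have := (phi_pos β h w).le; positivity)]
    exact mul_le_of_le_one_right (by positivity) (phi_lt_one β h w).le
  rw [h1]
  refine (abs_sub _ _).trans (add_le_add ((abs_add_le _ _).trans ?_) h3)
  gcongr

/-- Since `6T = n ∑ X_ij L_ij`, replacing each `L_ij` by `w` turns the triangle count into a
multiple of the edge count. -/
theorem abs_six_mul_numTriangles_sub_le (w : ℝ) (G : SimpleGraph (Fin n)) :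
    |6 * numTriangles G - n * w * (2 * numEdges G)| ≤ n * wedgeDev w G := by
  have h1 : 6 * numTriangles G - n * w * (2 * numEdges G) =
      n * ∑ i, ∑ k ∈ Finset.univ \ {i}, edgeVar G i k * (wedge G i k - w) := by
    rw [six_mul_numTriangles_eq_wedge, two_mul_numEdges,
      ← sum_offDiag_edgeVar G (fun i k => wedge G i k - w)]
    simp only [mul_sub, Finset.sum_sub_distrib, ← Finset.sum_mul]
    ring
  rw [h1, abs_mul, abs_of_nonneg (Nat.cast_nonneg n)]
  refine mul_le_mul_of_nonneg_left ?_ (Nat.cast_nonneg n)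
  refine (Finset.abs_sum_le_sum_abs _ _).trans (Finset.sum_le_sum fun i _ => ?_)
  refine (Finset.abs_sum_le_sum_abs _ _).trans (Finset.sum_le_sum fun k _ => ?_)
  rw [abs_mul, abs_of_nonneg (edgeVar_nonneg _ _ _)]
  exact mul_le_of_le_one_left (abs_nonneg _) (edgeVar_le_one _ _ _)

end Fluct

/-! ### The binomial random graph and bounds on the partition function -/

section Partition
variable {n : ℕ}

theorem numEdges_eq_ncard (G : SimpleGraph (Fin n)) : numEdges G = (G.edgeSet.ncard : ℝ) := by
  classical
  have h1 := two_mul_numEdges G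
  have h2 := G.sum_degrees_eq_twice_card_edges
  have h3 : ∀ i, ∑ j, edgeVar G i j = (G.degree i : ℝ) := by
    intro i
    rw [← G.card_neighborFinset_eq_degree, G.neighborFinset_eq_filter, Finset.card_filter]
    push_cast
    exact Finset.sum_congr rfl fun j _ => by unfold edgeVar; congr
  simp_rw [h3] at h1
  rw [← Nat.cast_sum, h2] at h1
  have h4 : G.edgeSet.ncard = G.edgeFinset.card := by
    rw [← SimpleGraph.coe_edgeFinset, Set.ncard_coe_finset]
  rw [h4]
  push_cast at h1
  linarith

theorem ncard_edgeSet_le (G : SimpleGraph (Fin n)) : G.edgeSet.ncard ≤ n.choose 2 := by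
  classical
  have := G.card_edgeFinset_le_card_choose_two
  rw [Fintype.card_fin] at this
  rwa [← SimpleGraph.coe_edgeFinset, Set.ncard_coe_finset]

theorem hamiltonian_zero (h : ℝ) (G : SimpleGraph (Fin n)) :
    hamiltonian 0 h G = h * numEdges G := by
  simp [hamiltonian]

theorem binomialRandom_real_singleton (β h : ℝ) (G : SimpleGraph (Fin n)) :
    (SimpleGraph.binomialRandom (Fin n) (baseProb β h)).real {G} =
      Real.exp (hamiltonian 0 h G) / (1 + Real.exp h) ^ n.choose 2 := by
  have hp : (1 : ℝ) + Real.exp h ≠ 0 := by positivity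
  rw [MeasureTheory.measureReal_def, SimpleGraph.binomialRandom_singleton]
  rw [ENNReal.toReal_mul, ENNReal.toReal_pow, ENNReal.toReal_pow, ENNReal.coe_toReal,
    ENNReal.coe_toReal, Nat.card_eq_fintype_card, Fintype.card_fin]
  have e1 : ((unitInterval.toNNReal (baseProb β h) : NNReal) : ℝ) = Real.exp h / (1 + Real.exp h) := by
    simp [baseProb, phi]
  have e2 : ((unitInterval.toNNReal (unitInterval.symm (baseProb β h)) : NNReal) : ℝ) =
      1 / (1 + Real.exp h) := by
    simp [baseProb, phi]
    field_simp
    ring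
  rw [e1, e2, hamiltonian_zero, numEdges_eq_ncard, mul_comm h, Real.exp_nat_mul, div_pow, div_pow,
    one_pow, div_mul_div_comm, mul_one, ← pow_add, Nat.add_sub_cancel' (ncard_edgeSet_le G)]

instance : MeasurableSingletonClass (SimpleGraph (Fin n)) where
  measurableSet_singleton G := by
    have : {G} = SimpleGraph.edgeSet ⁻¹' {G.edgeSet} := by ext; simp
    rw [this]
    exact SimpleGraph.measurable_edgeSet (measurableSet_singleton _)

/-- Read off from the total mass 1 of the binomial random graph. -/
theorem partitionFn_zero (n : ℕ) (h : ℝ) : partitionFn n 0 h = (1 + Real.exp h) ^ n.choose 2 := by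
  have h1 : ∑ G, (SimpleGraph.binomialRandom (Fin n) (baseProb 0 h)).real {G} = 1 := by
    rw [MeasureTheory.sum_measureReal_singleton]
    simp
  simp_rw [binomialRandom_real_singleton, ← Finset.sum_div] at h1
  rwa [div_eq_one_iff_eq (by positivity)] at h1

theorem binomialRandom_real_eq_gibbsProb (β h : ℝ) (A : Set (SimpleGraph (Fin n))) :
    (SimpleGraph.binomialRandom (Fin n) (baseProb β h)).real A = gibbsProb 0 h A := by
  classical
  have h1 : A = ((Finset.univ.filter (· ∈ A) : Finset (SimpleGraph (Fin n))) :
      Set (SimpleGraph (Fin n))) := by ext; simp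
  conv_lhs => rw [h1]
  rw [← MeasureTheory.sum_measureReal_singleton, Finset.sum_filter, gibbsProb, gibbsExp]
  refine Finset.sum_congr rfl fun G _ => ?_
  rw [binomialRandom_real_singleton, partitionFn_zero]
  by_cases hG : G ∈ A <;> simp [hG]

theorem log_partitionFn_zero (n : ℕ) (h : ℝ) :
    Real.log (partitionFn n 0 h) = (n * (n - 1) / 2 : ℝ) * Real.log (1 + Real.exp h) := by
  rw [partitionFn_zero, Real.log_pow, Nat.cast_choose_two]

theorem gibbsProb_mul_partitionFn (β h : ℝ) (A : Set (SimpleGraph (Fin n))) :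
    gibbsProb β h A * partitionFn n β h =
      ∑ G, A.indicator 1 G * Real.exp (hamiltonian β h G) := by
  rw [gibbsProb, gibbsExp_eq, div_mul_cancel₀ _ (partitionFn_pos β h n).ne']

theorem gibbsProb_mul_partitionFn_le {β h β' h' M : ℝ} {A : Set (SimpleGraph (Fin n))}
    (hA : ∀ G ∈ A, hamiltonian β h G ≤ hamiltonian β' h' G + M) :
    gibbsProb β h A * partitionFn n β h ≤
      gibbsProb β' h' A * partitionFn n β' h' * Real.exp M := by
  rw [gibbsProb_mul_partitionFn, gibbsProb_mul_partitionFn, Finset.sum_mul]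
  refine Finset.sum_le_sum fun G _ => ?_
  by_cases hG : G ∈ A
  · simp only [Set.indicator_of_mem hG, Pi.one_apply, one_mul, ← Real.exp_add]
    exact Real.exp_le_exp.2 (hA G hG)
  · simp [hG]

theorem gibbsProb_le_one {β h : ℝ} (A : Set (SimpleGraph (Fin n))) : gibbsProb β h A ≤ 1 := by
  rw [← gibbsExp_const β h (n := n) 1]
  refine gibbsExp_mono fun G => ?_
  by_cases hG : G ∈ A <;> simp [hG]

/-- Gibbs' variational lower bound with a product measure as trial measure. -/
theorem gibbsExp_hamiltonian_sub_le (β h h' : ℝ) :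
    gibbsExp 0 h' (fun G : SimpleGraph (Fin n) => hamiltonian β h G - hamiltonian 0 h' G) ≤
      Real.log (partitionFn n β h) - Real.log (partitionFn n 0 h') := by
  set f : SimpleGraph (Fin n) → ℝ := fun G => hamiltonian β h G - hamiltonian 0 h' G with hf
  set m := gibbsExp 0 h' f with hm
  have hZ : partitionFn n β h = partitionFn n 0 h' * gibbsExp 0 h' (fun G => Real.exp (f G)) := by
    rw [gibbsExp_eq, mul_div_cancel₀ _ (partitionFn_pos 0 h' n).ne', partitionFn]
    refine Finset.sum_congr rfl fun G _ => ?_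
    rw [← Real.exp_add, hf]; congr 1; ring
  have h1 : Real.exp m ≤ gibbsExp 0 h' (fun G => Real.exp (f G)) := by
    -- Jensen's inequality through the tangent line of `exp` at the mean `m`.
    have : gibbsExp 0 h' (fun G => Real.exp m * (f G - m + 1)) = Real.exp m := by
      rw [gibbsExp_const_mul, gibbsExp_add, gibbsExp_sub, gibbsExp_const, gibbsExp_const, ← hm]
      ring
    rw [← this]
    refine gibbsExp_mono fun G => ?_
    have h2 := Real.add_one_le_exp (f G - m)
    calc _ ≤ Real.exp m * Real.exp (f G - m) := by gcongr
      _ = _ := by rw [← Real.exp_add]; congr 1; ring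
  rw [hZ, Real.log_mul (partitionFn_pos 0 h' n).ne' ((Real.exp_pos m).trans_le h1).ne',
    add_sub_cancel_left, Real.le_log_iff_exp_le ((Real.exp_pos m).trans_le h1)]
  exact h1

theorem phi_zero_left (h x y : ℝ) : phi 0 h x = phi 0 h y := by simp [phi]

/-- Independence of the edges at `β = 0`: there `φ` is constant, so the conditional-probability
identity factorizes the expectation. The point `x` is a dummy. -/
theorem gibbsExp_zero_edgeVar_mul (h x : ℝ) {a b : Fin n} (hab : a ≠ b)
    (g : SimpleGraph (Fin n) → ℝ) (hg : ∀ G, g (G \ SimpleGraph.edge a b) = g G) :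
    gibbsExp 0 h (fun G => edgeVar G a b * g G) = phi 0 h x * gibbsExp 0 h g := by
  have h1 := gibbsExp_edge_sub_phi_mul (β := 0) (h := h) hab g
  simp only [hg, phi_zero_left h (wedge _ _ _) x, sub_mul] at h1
  rw [gibbsExp_sub, gibbsExp_const_mul] at h1
  linarith

theorem gibbsExp_zero_edgeVar (h x : ℝ) {a b : Fin n} (hab : a ≠ b) :
    gibbsExp 0 h (fun G => edgeVar G a b) = phi 0 h x := by
  have := gibbsExp_zero_edgeVar_mul h x hab (fun _ => 1) (fun _ => rfl)
  simpa [gibbsExp_const] using this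

theorem gibbsExp_zero_triangle (h x : ℝ) {i j k : Fin n} (hij : i ≠ j) (hjk : j ≠ k)
    (hik : i ≠ k) :
    gibbsExp 0 h (fun G => edgeVar G i j * edgeVar G j k * edgeVar G i k) = phi 0 h x ^ 3 := by
  have h1 := gibbsExp_zero_edgeVar_mul h x hij (fun G => edgeVar G j k * edgeVar G i k)
    (fun G => by
      rw [edgeVar_sdiff_edge G hij, edgeVar_sdiff_edge G hij, if_neg, if_neg] <;> grind)
  have h2 := gibbsExp_zero_edgeVar_mul h x hjk (fun G => edgeVar G i k)
    (fun G => by rw [edgeVar_sdiff_edge G hjk, if_neg]; grind)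
  rw [gibbsExp_zero_edgeVar h x hik] at h2
  rw [h2] at h1
  simp only [mul_assoc]
  rw [h1]; ring

theorem gibbsExp_zero_numEdges_le (h x : ℝ) :
    gibbsExp 0 h (fun G : SimpleGraph (Fin n) => 2 * numEdges G) ≤ n ^ 2 * phi 0 h x := by
  simp_rw [two_mul_numEdges, gibbsExp_sum]
  calc _ ≤ ∑ _i : Fin n, ∑ _j : Fin n, phi 0 h x := by
        refine Finset.sum_le_sum fun i _ => Finset.sum_le_sum fun j _ => ?_
        by_cases hij : i = j
        · subst hij
          simp only [edgeVar_self, gibbsExp_const]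
          exact (phi_pos 0 h x).le
        · exact (gibbsExp_zero_edgeVar h x hij).le
    _ = _ := by simp; ring

/-- The indicator of three distinct indices is at least `1 - 1[i=j] - 1[j=k] - 1[i=k]`, whose sum
over all triples is `n³ - 3n²`. -/
theorem le_gibbsExp_zero_numTriangles (h x : ℝ) :
    (n ^ 3 - 3 * n ^ 2 : ℝ) * phi 0 h x ^ 3 ≤
      gibbsExp 0 h (fun G : SimpleGraph (Fin n) => 6 * numTriangles G) := by
  simp_rw [six_mul_numTriangles, gibbsExp_sum]
  calc _ = ∑ i : Fin n, ∑ j : Fin n, ∑ k : Fin n, (1 - (if i = j then 1 else 0) -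
        (if j = k then 1 else 0) - (if i = k then 1 else 0)) * phi 0 h x ^ 3 := by
        simp [← Finset.sum_mul, Finset.sum_sub_distrib]
        ring
    _ ≤ _ := by
        refine Finset.sum_le_sum fun i _ => Finset.sum_le_sum fun j _ =>
          Finset.sum_le_sum fun k _ => ?_
        have hp : 0 < phi 0 h x ^ 3 := pow_pos (phi_pos 0 h x) 3
        by_cases hd : i ≠ j ∧ j ≠ k ∧ i ≠ k
        · rw [gibbsExp_zero_triangle h x hd.1 hd.2.1 hd.2.2]
          simp [hd.1, hd.2.1, hd.2.2]
        · refine le_trans ?_ (gibbsExp_nonneg fun G => mul_nonneg (mul_nonneg (edgeVar_nonneg _ _ _)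
            (edgeVar_nonneg _ _ _)) (edgeVar_nonneg _ _ _))
          refine mul_nonpos_of_nonpos_of_nonneg ?_ hp.le
          split_ifs <;> first | (exfalso; tauto) | norm_num

/-- The limit of `log Z_n / n²` predicted by a root `w` of `ψ`. -/
def freeEnergy (β h w : ℝ) : ℝ :=
  Real.log (1 + Real.exp (β * w + h)) / 2 - β * phi β h w ^ 3 / 3

theorem phi_zero_shift (β h w x : ℝ) : phi 0 (β * w + h) x = phi β h w := by simp [phi]

/-- The trial measure is the product measure with field `βw + h`, that is, with edge density `p =
φ(w)`. With `w = p²` its expected energy difference is `n²(βp³/6 - βp³/2)` up to `O(n)`. -/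
theorem freeEnergy_lower {β h w : ℝ} (hβ : 0 ≤ β) (hw : psi β h w = 0) :
    ∃ C : ℝ, 0 ≤ C ∧ ∀ n : ℕ, 0 < n →
      n ^ 2 * freeEnergy β h w - C * n ≤ Real.log (partitionFn n β h) := by
  set p := phi β h w with hp
  have hp0 : 0 < p := phi_pos _ _ _
  have hwp : w = p ^ 2 := by rw [psi] at hw; linarith
  set ℓ := Real.log (1 + Real.exp (β * w + h)) with hℓ
  have hℓ0 : 0 ≤ ℓ := Real.log_nonneg (by linarith [Real.exp_pos (β * w + h)])
  refine ⟨ℓ / 2 + β * p ^ 3 / 2, by positivity, fun n hn => ?_⟩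
  have hn' : (0 : ℝ) < n := by exact_mod_cast hn
  have h1 := gibbsExp_hamiltonian_sub_le (n := n) β h (β * w + h)
  have h2 : gibbsExp 0 (β * w + h)
      (fun G : SimpleGraph (Fin n) => hamiltonian β h G - hamiltonian 0 (β * w + h) G) =
      β / (6 * n) * gibbsExp 0 (β * w + h) (fun G : SimpleGraph (Fin n) => 6 * numTriangles G) -
      β * w / 2 * gibbsExp 0 (β * w + h) (fun G : SimpleGraph (Fin n) => 2 * numEdges G) := by
    rw [← gibbsExp_const_mul, ← gibbsExp_const_mul, ← gibbsExp_sub]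
    refine gibbsExp_congr fun G => ?_
    rw [hamiltonian, hamiltonian_zero]
    field_simp
    ring
  have h3 := gibbsExp_zero_numEdges_le (n := n) (β * w + h) 0
  have h4 := le_gibbsExp_zero_numTriangles (n := n) (β * w + h) 0
  rw [phi_zero_shift, ← hp] at h3 h4
  have h5 : β / (6 * n) * ((n ^ 3 - 3 * n ^ 2 : ℝ) * p ^ 3) ≤ _ :=
    mul_le_mul_of_nonneg_left h4 (by positivity)
  have h6 : _ ≤ β * w / 2 * (n ^ 2 * p) :=
    mul_le_mul_of_nonneg_left h3 (by rw [hwp]; positivity)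
  rw [log_partitionFn_zero, ← hℓ, h2] at h1
  have h7 : β / (6 * n) * ((n ^ 3 - 3 * n ^ 2 : ℝ) * p ^ 3) = β * p ^ 3 * (n ^ 2 / 6 - n / 2) := by
    field_simp
    ring
  rw [h7] at h5
  have h8 : β * w / 2 * (n ^ 2 * p) = β * p ^ 3 * (n ^ 2 / 2) := by
    rw [hwp]; ring
  rw [h8] at h6
  rw [freeEnergy, ← hℓ, ← hp]
  linarith

/-- Configurations whose wedge densities are mostly near a root `w` of `ψ` contribute to the
partition function at most what `freeEnergy` predicts. -/
theorem gibbsProb_mul_partitionFn_near_le {β h w : ℝ} (hβ : 0 ≤ β) (hw : psi β h w = 0)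
    (hw1 : w ≤ 1) {n : ℕ} (hn : 0 < n) {τ : ℝ} {A : Set (SimpleGraph (Fin n))}
    (hA : ∀ G ∈ A, |edgeFluct β h G| ≤ τ * n ^ 2 ∧ wedgeDev w G ≤ τ * n ^ 2) :
    gibbsProb β h A * partitionFn n β h ≤
      Real.exp (n ^ 2 * (freeEnergy β h w + β * (1 + β) * τ) + β * n) := by
  set p := phi β h w with hp
  have hp0 : 0 < p := phi_pos _ _ _
  have hwp : w = p ^ 2 := by rw [psi] at hw; linarith
  have hw0 : 0 ≤ w := by rw [hwp]; positivity
  set ℓ := Real.log (1 + Real.exp (β * w + h)) with hℓ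
  have hℓ0 : 0 ≤ ℓ := Real.log_nonneg (by linarith [Real.exp_pos (β * w + h)])
  have hn' : (0 : ℝ) < n := by exact_mod_cast hn
  -- On `A` one has `6T ≈ nw · 2E` and `2E ≈ n²p`, so `βT/n - βwE ≈ -(βw/3) · 2E ≈ -n²βp³/3`: up to
  -- this constant, the energy is that of a product measure.
  have h1 : ∀ G ∈ A, hamiltonian β h G ≤ hamiltonian 0 (β * w + h) G +
      (n ^ 2 * (- β * p ^ 3 / 3 + β * (1 + β) * τ) + β * n) := by
    intro G hG
    obtain ⟨a1, a2⟩ := hA G hG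
    have hτ : 0 ≤ τ * n ^ 2 := (abs_nonneg _).trans a1
    have b1 := abs_two_mul_numEdges_sub_le (h := h) hβ w G
    have b2 := abs_six_mul_numTriangles_sub_le w G
    rw [← hp] at b1
    have b3 : β * wedgeDev w G ≤ β * (τ * n ^ 2) := by gcongr
    have c1 : n ^ 2 * p - ((1 + β) * (τ * n ^ 2) + n) ≤ 2 * numEdges G := by
      have := (abs_le.1 b1).1; linarith
    have c2 : 6 * numTriangles G ≤ n * (w * (2 * numEdges G) + τ * n ^ 2) := by
      have := (abs_le.1 b2).2
      have : n * wedgeDev w G ≤ n * (τ * n ^ 2) := by gcongr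
      linarith
    have c3 : β / n * numTriangles G ≤ β / 6 * (w * (2 * numEdges G) + τ * n ^ 2) := by
      have : β / (6 * n) * (6 * numTriangles G) ≤
          β / (6 * n) * (n * (w * (2 * numEdges G) + τ * n ^ 2)) := by gcongr
      have e1 : β / (6 * n) * (6 * numTriangles G) = β / n * numTriangles G := by field_simp
      have e2 : β / (6 * n) * (n * (w * (2 * numEdges G) + τ * n ^ 2)) =
        β / 6 * (w * (2 * numEdges G) + τ * n ^ 2) := by field_simp
      linarith
    have c4 : β * w / 3 * (n ^ 2 * p - ((1 + β) * (τ * n ^ 2) + n)) ≤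
        β * w / 3 * (2 * numEdges G) := by gcongr
    have c5 : β * w / 3 * ((1 + β) * (τ * n ^ 2) + n) ≤ β * 1 / 3 * ((1 + β) * (τ * n ^ 2) + n) := by
      gcongr
    have c6 : β * w / 3 * (n ^ 2 * p) = n ^ 2 * (β * p ^ 3 / 3) := by rw [hwp]; ring
    rw [hamiltonian, hamiltonian_zero]
    have c7 : 0 ≤ β * β * (τ * n ^ 2) := by positivity
    have c8 : 0 ≤ β * (τ * n ^ 2) := by positivity
    have c9 : 0 ≤ β * n := by positivity
    nlinarith
  refine (gibbsProb_mul_partitionFn_le h1).trans ?_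
  have h2 : partitionFn n 0 (β * w + h) ≤ Real.exp (n ^ 2 * (ℓ / 2)) := by
    rw [← Real.exp_log (partitionFn_pos 0 (β * w + h) n), log_partitionFn_zero, ← hℓ]
    refine Real.exp_le_exp.2 ?_
    nlinarith [mul_nonneg hn'.le hℓ0]
  calc _ ≤ 1 * Real.exp (n ^ 2 * (ℓ / 2)) * Real.exp _ := by
        gcongr
        · exact (partitionFn_pos _ _ _).le
        · exact gibbsProb_le_one A
    _ = _ := by
        rw [one_mul, ← Real.exp_add, freeEnergy, ← hℓ, ← hp]; congr 1; ring

end Partition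

/-! ### Analysis near the two roots -/

theorem psi_zero_pos (β h : ℝ) : 0 < psi β h 0 := by
  rw [psi, sub_zero]; exact pow_pos (phi_pos β h 0) 2

theorem psi_neg_of_one_le (β h : ℝ) {x : ℝ} (hx : 1 ≤ x) : psi β h x < 0 := by
  have h1 := phi_pos β h x
  have h2 := phi_lt_one β h x
  rw [psi]; nlinarith

/-- `ψ` is nonnegative before the transversal root `u` and nonpositive after it. -/
theorem psi_sign {β h u v : ℝ} (hroot : ∀ x, psi β h x = 0 ↔ x = u ∨ x = v)
    (hd : 2 * phi β h u * (β * (phi β h u * (1 - phi β h u))) < 1) :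
    (∀ x, 0 ≤ x → x < u → 0 ≤ psi β h x) ∧ (∀ x, u < x → psi β h x ≤ 0) := by
  have hc := continuous_psi β h
  have hu0 : psi β h u = 0 := (hroot u).2 (Or.inl rfl)
  have hder := hasDerivAt_psi β h u
  have hneg : 2 * phi β h u * (β * (phi β h u * (1 - phi β h u))) - 1 < 0 := by linarith
  have hev := hasDerivAt_iff_tendsto_slope.1 hder |>.eventually (gt_mem_nhds hneg)
  have hright : ∀ x, u < x → ∃ y, u < y ∧ y < x ∧ psi β h y < 0 := by
    intro x hx
    have h1 : ∀ᶠ y in nhdsWithin u (Set.Ioi u), slope (psi β h) u y < 0 :=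
      hev.filter_mono (nhdsWithin_mono _ fun y hy => ne_of_gt hy)
    obtain ⟨y, hy, hyx⟩ := (h1.and (Ioo_mem_nhdsGT hx)).exists
    refine ⟨y, hyx.1, hyx.2, ?_⟩
    rw [slope_def_field, hu0, sub_zero] at hy
    exact (div_neg_iff.1 hy).resolve_left (fun h => absurd h.2 (not_lt.2 (sub_pos.2 hyx.1).le)) |>.1
  have hleft : ∀ x, x < u → ∃ y, x < y ∧ y < u ∧ 0 < psi β h y := by
    intro x hx
    have h1 : ∀ᶠ y in nhdsWithin u (Set.Iio u), slope (psi β h) u y < 0 :=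
      hev.filter_mono (nhdsWithin_mono _ fun y hy => ne_of_lt hy)
    obtain ⟨y, hy, hyx⟩ := (h1.and (Ioo_mem_nhdsLT hx)).exists
    refine ⟨y, hyx.1, hyx.2, ?_⟩
    rw [slope_def_field, hu0, sub_zero] at hy
    exact (div_neg_iff.1 hy).resolve_right (fun h => absurd h.2 (not_lt.2 (sub_neg.2 hyx.2).le)) |>.1
  -- A wrong sign on either side of `u` would produce two distinct roots on that side: one between
  -- the offending point and the endpoint 0 or 1, where the sign of `ψ` is known, and one between it
  -- and a point close to `u`, where the slope fixes the sign. Only `v` is available for both.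
  constructor
  · intro x hx0 hxu
    by_contra hcon
    push Not at hcon
    obtain ⟨y, hxy, hyu, hy⟩ := hleft x hxu
    obtain ⟨z₁, hz₁, e₁⟩ := intermediate_value_Icc' hx0 hc.continuousOn
      (show (0 : ℝ) ∈ Set.Icc _ _ from ⟨hcon.le, (psi_zero_pos β h).le⟩)
    obtain ⟨z₂, hz₂, e₂⟩ := intermediate_value_Icc hxy.le hc.continuousOn
      (show (0 : ℝ) ∈ Set.Icc _ _ from ⟨hcon.le, hy.le⟩)
    have a1 : z₁ ≠ x := by rintro rfl; exact hcon.ne e₁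
    have b1 : z₁ < x := lt_of_le_of_ne hz₁.2 a1
    have c1 := ((hroot z₁).1 e₁).resolve_left (b1.trans hxu).ne
    have c2 := ((hroot z₂).1 e₂).resolve_left (hz₂.2.trans_lt hyu).ne
    linarith [hz₂.1]
  · intro x hux
    by_contra hcon
    push Not at hcon
    have hx1 : x < 1 := by
      by_contra h'
      exact absurd (psi_neg_of_one_le β h (not_lt.1 h')) hcon.not_gt
    obtain ⟨y, huy, hyx, hy⟩ := hright x hux
    obtain ⟨z₁, hz₁, e₁⟩ := intermediate_value_Icc' hx1.le hc.continuousOn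
      (show (0 : ℝ) ∈ Set.Icc _ _ from ⟨(psi_neg_of_one_le β h le_rfl).le, hcon.le⟩)
    obtain ⟨z₂, hz₂, e₂⟩ := intermediate_value_Icc hyx.le hc.continuousOn
      (show (0 : ℝ) ∈ Set.Icc _ _ from ⟨hy.le, hcon.le⟩)
    have a1 : z₁ ≠ x := by rintro rfl; exact hcon.ne' e₁
    have b1 : x < z₁ := lt_of_le_of_ne hz₁.1 a1.symm
    have c1 := ((hroot z₁).1 e₁).resolve_left (hux.trans b1).ne'
    have c2 := ((hroot z₂).1 e₂).resolve_left (huy.trans_le hz₂.1).ne'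
    linarith [hz₂.2]

theorem phi_eq_sqrt {β h w : ℝ} (hw : psi β h w = 0) : phi β h w = Real.sqrt w := by
  rw [psi, sub_eq_zero] at hw
  rw [eq_comm, Real.sqrt_eq_iff_mul_self_eq_of_pos (phi_pos β h w), ← sq, hw]

theorem hasDerivAt_freeEnergy_aux (β h : ℝ) {w : ℝ} (hw : 0 < w) :
    HasDerivAt (fun w => Real.log (1 + Real.exp (β * w + h)) / 2 - β * (w * Real.sqrt w) / 3)
      (β / 2 * (phi β h w - Real.sqrt w)) w := by
  have h1 : HasDerivAt (fun x => Real.exp (β * x + h)) (Real.exp (β * w + h) * β) w := by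
    simpa using (((hasDerivAt_id w).const_mul β).add_const h).exp
  have h2 := ((h1.const_add 1).log (by positivity)).div_const 2
  have h3 := (((hasDerivAt_id w).mul (Real.hasDerivAt_sqrt hw.ne')).const_mul β).div_const 3
  refine (h2.sub h3).congr_deriv ?_
  have hs : 0 < Real.sqrt w := Real.sqrt_pos.2 hw
  have e : w / (2 * Real.sqrt w) = Real.sqrt w / 2 := by
    rw [div_eq_div_iff (by positivity) (by norm_num)]
    linear_combination -2 * Real.mul_self_sqrt hw.le
  simp only [id, one_mul, mul_one_div, e, phi]
  ring

/-- At roots `φ(w) = √w`, so `freeEnergy` agrees there with a function of `w` whose derivative is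
`(β/2)(φ(w) - √w)`. This has the sign of `ψ`, so the function strictly increases along the way from
`v` to `u`, whichever is larger. -/
theorem freeEnergy_lt {β h u v : ℝ} (hβ : 0 < β) (huv : u ≠ v)
    (hroot : ∀ x, psi β h x = 0 ↔ x = u ∨ x = v)
    (hu : u ∈ Set.Ioo (0 : ℝ) 1) (hv : 0 < v)
    (hd : 2 * phi β h u * (β * (phi β h u * (1 - phi β h u))) < 1) :
    freeEnergy β h v < freeEnergy β h u := by
  obtain ⟨s1, s2⟩ := psi_sign hroot hd
  set g : ℝ → ℝ := fun w => Real.log (1 + Real.exp (β * w + h)) / 2 - β * (w * Real.sqrt w) / 3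
    with hg
  have hgroot : ∀ w, psi β h w = 0 → freeEnergy β h w = g w := by
    intro w hw
    rw [freeEnergy, hg, phi_eq_sqrt hw]
    have hw0 : 0 ≤ w := by rw [psi, sub_eq_zero] at hw; rw [← hw]; positivity
    have := Real.mul_self_sqrt hw0
    simp only
    rw [pow_succ, sq, this]
  rw [hgroot v ((hroot v).2 (Or.inr rfl)), hgroot u ((hroot u).2 (Or.inl rfl))]
  have hder : ∀ w, 0 < w → deriv g w = β / 2 * (phi β h w - Real.sqrt w) :=
    fun w hw => (hasDerivAt_freeEnergy_aux β h hw).deriv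
  have hcont : ContinuousOn g (Set.Ioi 0) := fun w hw =>
    (hasDerivAt_freeEnergy_aux β h hw).continuousAt.continuousWithinAt
  rcases lt_or_gt_of_ne huv with hlt | hgt
  · refine strictAntiOn_of_deriv_neg (convex_Icc u v)
      (hcont.mono fun x hx => hu.1.trans_le hx.1) (fun x hx => ?_)
      (Set.left_mem_Icc.2 hlt.le) (Set.right_mem_Icc.2 hlt.le) hlt
    rw [interior_Icc] at hx
    have hx0 : 0 < x := hu.1.trans hx.1
    rw [hder x hx0]
    have h1 : psi β h x < 0 := lt_of_le_of_ne (s2 x hx.1) fun e =>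
      ((hroot x).1 e).elim hx.1.ne' hx.2.ne
    have h2 : phi β h x < Real.sqrt x := Real.lt_sqrt_of_sq_lt (by rw [psi] at h1; linarith)
    exact mul_neg_of_pos_of_neg (by positivity) (by linarith)
  · refine strictMonoOn_of_deriv_pos (convex_Icc v u)
      (hcont.mono fun x hx => hv.trans_le hx.1) (fun x hx => ?_)
      (Set.left_mem_Icc.2 hgt.le) (Set.right_mem_Icc.2 hgt.le) hgt
    rw [interior_Icc] at hx
    have hx0 : 0 < x := hv.trans hx.1
    rw [hder x hx0]
    have h1 : 0 < psi β h x := lt_of_le_of_ne (s1 x hx0.le hx.2) fun e =>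
      ((hroot x).1 e.symm).elim hx.2.ne hx.1.ne'
    have h2 : Real.sqrt x < phi β h x :=
      (Real.sqrt_lt' (phi_pos _ _ _)).2 (by rw [psi] at h1; linarith)
    exact mul_pos (by positivity) (by linarith)

theorem monotone_phi {β : ℝ} (hβ : 0 ≤ β) (h : ℝ) : Monotone (phi β h) := by
  refine monotone_of_deriv_nonneg (fun x => (hasDerivAt_phi β h x).differentiableAt) fun x => ?_
  rw [(hasDerivAt_phi β h x).deriv]
  have h1 := phi_pos β h x
  have h2 := sub_pos.2 (phi_lt_one β h x)
  positivity

theorem exists_le_phi_sub_phi {β : ℝ} (hβ : 0 < β) (h : ℝ) :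
    ∃ c, 0 < c ∧ ∀ x y, 0 ≤ x → x ≤ y → y ≤ 1 → c * (y - x) ≤ phi β h y - phi β h x := by
  have h0 := phi_pos β h 0
  have h1 := sub_pos.2 (phi_lt_one β h 1)
  refine ⟨β * (phi β h 0 * (1 - phi β h 1)), by positivity, fun x y hx hxy hy => ?_⟩
  refine (convex_Icc (0 : ℝ) 1).mul_sub_le_image_sub_of_le_deriv
    (continuous_phi β h).continuousOn
    (fun z _ => (hasDerivAt_phi β h z).differentiableAt.differentiableWithinAt)
    (fun z hz => ?_) x ⟨hx, hxy.trans hy⟩ y ⟨hx.trans hxy, hy⟩ hxy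
  rw [interior_Icc] at hz
  rw [(hasDerivAt_phi β h z).deriv]
  have m0 := monotone_phi hβ.le h hz.1.le
  have m1 := monotone_phi hβ.le h hz.2.le
  have m2 := (phi_pos β h z).le
  gcongr

/-- If `x` and `y` lie, up to `δ`, on one side of `v`, then `φ(x)φ(y)` deviates from `φ(v)²` to
the same side at least linearly in `|x - v|`. -/
theorem exists_le_phi_mul_phi_sub {β : ℝ} (hβ : 0 < β) (h : ℝ) {v : ℝ} (hv : v ∈ Set.Icc (0 : ℝ) 1) :
    ∃ c κ, 0 < c ∧ 0 ≤ κ ∧ ∀ s : ℝ, s = 1 ∨ s = -1 → ∀ δ, 0 ≤ δ →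
      ∀ x ∈ Set.Icc (0 : ℝ) 1, ∀ y ∈ Set.Icc (0 : ℝ) 1, -δ ≤ s * (x - v) → -δ ≤ s * (y - v) →
        c * |x - v| - κ * δ ≤ s * (phi β h x * phi β h y - phi β h v ^ 2) := by
  obtain ⟨c, hc, H⟩ := exists_le_phi_sub_phi hβ h
  have h0 := phi_pos β h 0
  refine ⟨c * phi β h 0, 2 * (β + c), by positivity, by positivity, ?_⟩
  intro s hs δ hδ x hx y hy hxs hys
  have key : ∀ z ∈ Set.Icc (0 : ℝ) 1, -δ ≤ s * (z - v) →
      c * |z - v| - (β + c) * δ ≤ s * (phi β h z - phi β h v) := by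
    intro z hz hzs
    have hL := abs_phi_sub_phi_le hβ.le h z v
    have hcδ : 0 ≤ c * δ := by positivity
    have hbδ : 0 ≤ β * δ := by positivity
    rcases hs with rfl | rfl
    · rcases le_total v z with hvz | hvz
      · have := H v z hv.1 hvz hz.2
        rw [abs_of_nonneg (sub_nonneg.2 hvz)]; linarith
      · have h1 : |z - v| ≤ δ := by rw [abs_of_nonpos (by linarith)]; linarith
        have h2 := mul_le_mul_of_nonneg_left h1 hc.le
        have h3 := mul_le_mul_of_nonneg_left h1 hβ.le
        have := (abs_le.1 hL).1
        linarith
    · rcases le_total z v with hvz | hvz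
      · have := H z v hz.1 hvz hv.2
        rw [abs_of_nonpos (sub_nonpos.2 hvz)]; linarith
      · have h1 : |z - v| ≤ δ := by rw [abs_of_nonneg (by linarith)]; linarith
        have h2 := mul_le_mul_of_nonneg_left h1 hc.le
        have h3 := mul_le_mul_of_nonneg_left h1 hβ.le
        have := (abs_le.1 hL).2
        linarith
  have kx := key x hx hxs
  have ky := key y hy hys
  have e1 : s * (phi β h x * phi β h y - phi β h v ^ 2) =
    s * (phi β h x - phi β h v) * phi β h y + phi β h v * (s * (phi β h y - phi β h v)) := by ring
  have py0 := monotone_phi hβ.le h hy.1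
  have py1 := (phi_lt_one β h y).le
  have pv0 := (phi_pos β h v).le
  have pv1 := (phi_lt_one β h v).le
  have hκ : 0 ≤ (β + c) * δ := by positivity
  have a1 : 0 ≤ c * |x - v| := by positivity
  have a2 : 0 ≤ c * |y - v| := by positivity
  have b1 := mul_le_mul_of_nonneg_right kx (h0.le.trans py0)
  have b2 := mul_le_mul_of_nonneg_left ky pv0
  have b3 := mul_le_mul_of_nonneg_left py0 a1
  have b4 := mul_le_mul_of_nonneg_left py1 hκ
  have b5 := mul_le_mul_of_nonneg_right pv1 hκ
  have b6 := mul_nonneg pv0 a2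
  rw [e1]
  nlinarith

/-- With `p = φ(u)` and `a = φ'(u)` the local Lipschitz constant in each variable is close to `pa <
1/2`; the slack `η` keeps `(p+η)(a+η)` below 1/2. Two variables enter, so `Λ < 1/2` is what
contraction requires. -/
theorem exists_abs_phi_mul_phi_sub_le {β h u : ℝ} (hβ : 0 ≤ β)
    (hd : 2 * phi β h u * (β * (phi β h u * (1 - phi β h u))) < 1) :
    ∃ Λ δ, 0 ≤ Λ ∧ Λ < 1 / 2 ∧ 0 < δ ∧ ∀ x y, |x - u| ≤ δ → |y - u| ≤ δ →
      |phi β h x * phi β h y - phi β h u ^ 2| ≤ Λ * (|x - u| + |y - u|) := by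
  set p := phi β h u with hp
  have hp0 : 0 < p := phi_pos β h u
  have hp1 : p < 1 := phi_lt_one β h u
  set a := β * (p * (1 - p)) with ha
  have ha0 : 0 ≤ a := by have := sub_pos.2 hp1; positivity
  have hpa : 0 ≤ p * a := by positivity
  set η := (1 / 2 - p * a) / (2 * (1 + a)) with hη
  have hη0 : 0 < η := div_pos (by linarith) (by positivity)
  have hη1 : η ≤ 1 := by
    rw [hη, div_le_one (by positivity)]; linarith
  have hΛ : (p + η) * (a + η) < 1 / 2 := by
    have e : η * (2 * (1 + a)) = 1 / 2 - p * a := by rw [hη]; field_simp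
    have e3 : (p + η) * η ≤ 2 * η := by gcongr; linarith
    have e4 : (p + η) * η < 2 * η := by gcongr; linarith
    have e5 : (p + η) * (a + η) = p * a + η * a + (p + η) * η := by ring
    have e6 : 0 ≤ η * a := by positivity
    linarith
  have hder : HasDerivAt (phi β h) a u := hasDerivAt_phi β h u
  have hev := (hasDerivAt_iff_isLittleO.1 hder).bound hη0
  obtain ⟨δ₁, hδ₁, H⟩ := Metric.eventually_nhds_iff.1 hev
  refine ⟨(p + η) * (a + η), min (δ₁ / 2) (η / (β + 1)), by positivity, hΛ, by positivity,
    fun x y hx hy => ?_⟩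
  have key : ∀ z, |z - u| ≤ min (δ₁ / 2) (η / (β + 1)) → |phi β h z - p| ≤ (a + η) * |z - u| := by
    intro z hz
    have h1 := H (y := z) (by
      rw [Real.dist_eq]; have := hz.trans (min_le_left _ _); linarith)
    simp only [smul_eq_mul, Real.norm_eq_abs] at h1
    have h2 : phi β h z - p = (phi β h z - p - (z - u) * a) + (z - u) * a := by ring
    rw [h2]
    refine (abs_add_le _ _).trans ?_
    rw [abs_mul (z - u), abs_of_nonneg ha0]
    linarith
  have kx := key x hx
  have ky := key y hy
  have hy' : phi β h y ≤ p + η := by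
    have h1 := (abs_le.1 (abs_phi_sub_phi_le hβ h y u)).2
    have h2 : β * |y - u| ≤ (β + 1) * (η / (β + 1)) := by
      have := hy.trans (min_le_right _ _)
      gcongr
      linarith
    rw [mul_div_cancel₀ _ (by positivity : β + 1 ≠ 0)] at h2
    linarith
  have e1 : phi β h x * phi β h y - p ^ 2 = (phi β h x - p) * phi β h y + p * (phi β h y - p) := by
    ring
  rw [e1]
  refine (abs_add_le _ _).trans ?_
  rw [abs_mul, abs_mul, abs_of_pos (phi_pos β h y), abs_of_pos hp0]
  calc |phi β h x - p| * phi β h y + p * |phi β h y - p|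
      ≤ ((a + η) * |x - u|) * (p + η) + (p + η) * ((a + η) * |y - u|) := by
        have := (phi_pos β h y).le
        gcongr
        linarith
    _ = _ := by ring

theorem exists_le_abs_psi {β h u v : ℝ} (hroot : ∀ x, psi β h x = 0 ↔ x = u ∨ x = v) {δ : ℝ}
    (hδ : 0 < δ) :
    ∃ ε, 0 < ε ∧ ∀ x ∈ Set.Icc (0 : ℝ) 1, δ ≤ |x - u| → δ ≤ |x - v| → ε ≤ |psi β h x| := by
  set K : Set ℝ := Set.Icc (0 : ℝ) 1 ∩ ({x | δ ≤ |x - u|} ∩ {x | δ ≤ |x - v|}) with hK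
  have hKc : IsCompact K := isCompact_Icc.inter_right
    ((isClosed_le continuous_const (by fun_prop)).inter (isClosed_le continuous_const (by fun_prop)))
  rcases K.eq_empty_or_nonempty with he | hne
  · refine ⟨1, one_pos, fun x hx h1 h2 => ?_⟩
    have : x ∈ K := ⟨hx, h1, h2⟩
    rw [he] at this
    exact this.elim
  · obtain ⟨z, hz, hmin⟩ := hKc.exists_isMinOn hne (continuous_psi β h).abs.continuousOn
    refine ⟨|psi β h z|, abs_pos.2 fun e => ?_, fun x hx h1 h2 => hmin ⟨hx, h1, h2⟩⟩
    obtain ⟨-, h1, h2⟩ := hz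
    rcases (hroot z).1 e with rfl | rfl
    · simp only [Set.mem_ofPred_eq, sub_self, abs_zero] at h1; linarith
    · simp only [Set.mem_ofPred_eq, sub_self, abs_zero] at h2; linarith

/-! ### Approximate solutions of the mean-field equation -/

section MeanField
variable {n : ℕ} {β h : ℝ}

theorem card_univ_sdiff_pair {i j : Fin n} (hij : i ≠ j) :
    ((Finset.univ \ {i, j} : Finset (Fin n)).card : ℝ) = n - 2 := by
  have h1 := Finset.card_sdiff_add_card_inter (Finset.univ : Finset (Fin n)) {i, j}
  rw [Finset.univ_inter, Finset.card_pair hij, Finset.card_univ, Fintype.card_fin] at h1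
  have h2 : ((Finset.univ \ {i, j} : Finset (Fin n)).card : ℝ) + 2 = n := by exact_mod_cast h1
  linarith

/-- When all entries lie on one side of `v` up to `δ`, the terms `φ(L_ik)φ(L_jk) - φ(v)²` share a
sign and each is at least linear in `|L_ik - v|`. Their average is about `L_ij - v`, so one entry
close to `v` controls its whole row. No condition on `ψ'(v)` enters. -/
theorem exists_row_dev_le (hβ : 0 < β) {v : ℝ} (hv : v ∈ Set.Icc (0 : ℝ) 1) (hψ : psi β h v = 0) :
    ∃ C, 0 ≤ C ∧ ∀ (n : ℕ) (L : Fin n → Fin n → ℝ) (δ s : ℝ), (∀ i j, L i j ∈ Set.Icc (0 : ℝ) 1) →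
      1 ≤ n * δ → (s = 1 ∨ s = -1) →
      (∀ i j, i ≠ j → |L i j - (1 / (n : ℝ)) * ∑ k ∈ Finset.univ \ {i, j},
        phi β h (L i k) * phi β h (L j k)| ≤ δ) →
      (∀ i j, i ≠ j → -δ ≤ s * (L i j - v)) → ∀ i j, i ≠ j →
      ∑ k ∈ Finset.univ \ {i}, |L i k - v| ≤ C * n * (|L i j - v| + δ) := by
  obtain ⟨c, κ, hc, hκ, H⟩ := exists_le_phi_mul_phi_sub hβ h hv
  refine ⟨(3 + κ) / c + 1, by positivity, fun n L δ s hL hn hs hΔ hside i j hij => ?_⟩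
  have hn0 : (0 : ℝ) < n := by exact_mod_cast Fin.pos i
  have hδ : 0 ≤ δ := by
    by_contra hcon
    have := mul_neg_of_pos_of_neg hn0 (not_le.1 hcon)
    linarith
  have hs1 : |s| = 1 := by rcases hs with rfl | rfl <;> simp
  have hpv : phi β h v ^ 2 = v := by rw [psi] at hψ; linarith
  set S : Finset (Fin n) := Finset.univ \ {i, j} with hS
  set P := ∑ k ∈ S, phi β h (L i k) * phi β h (L j k) with hP
  have h1 : ∑ k ∈ S, (c * |L i k - v| - κ * δ) ≤
      ∑ k ∈ S, s * (phi β h (L i k) * phi β h (L j k) - phi β h v ^ 2) := by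
    refine Finset.sum_le_sum fun k hk => ?_
    have hk' : k ≠ i ∧ k ≠ j := by simpa [hS] using hk
    exact H s hs δ hδ _ (hL i k) _ (hL j k) (hside i k hk'.1.symm) (hside j k hk'.2.symm)
  rw [Finset.sum_sub_distrib, ← Finset.mul_sum S _ c, ← Finset.mul_sum S _ s, Finset.sum_sub_distrib,
    Finset.sum_const, Finset.sum_const, nsmul_eq_mul, nsmul_eq_mul, card_univ_sdiff_pair hij, hpv,
    ← hP] at h1
  -- The sum omits `k = i, j`, hence the correction `2v`, bounded by 2.
  have h2 : s * (P - (n - 2) * v) ≤ n * (|L i j - v| + δ) + 2 := by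
    have e : s * (P - (n - 2) * v) = s * (n * (L i j - v)) -
        s * (n * (L i j - 1 / (n : ℝ) * P)) + s * (2 * v) := by
      field_simp; ring
    have b : ∀ x, s * x ≤ |x| := fun x => by
      calc s * x ≤ |s * x| := le_abs_self _
        _ = |x| := by rw [abs_mul, hs1, one_mul]
    have b' : ∀ x, -(s * x) ≤ |x| := fun x => by
      calc -(s * x) ≤ |s * x| := neg_le_abs _
        _ = |x| := by rw [abs_mul, hs1, one_mul]
    have c1 := b (n * (L i j - v))
    have c2 := b' (n * (L i j - 1 / (n : ℝ) * P))
    have c3 := b (2 * v)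
    rw [abs_mul, abs_of_pos hn0] at c1 c2
    rw [abs_of_nonneg (by linarith [hv.1])] at c3
    have c4 := mul_le_mul_of_nonneg_left (hΔ i j hij) hn0.le
    have c5 := hv.2
    rw [e]
    linarith
  have h3 : ∑ k ∈ Finset.univ \ {i}, |L i k - v| ≤ ∑ k ∈ S, |L i k - v| + 1 := by
    have hj : j ∈ (Finset.univ \ {i} : Finset (Fin n)) := by simp [hij.symm]
    rw [← Finset.sum_erase_add _ _ hj]
    have : (Finset.univ \ {i} : Finset (Fin n)).erase j = S := by
      ext k; simp [hS]; tauto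
    rw [this]
    gcongr
    have a1 := hL i j
    rw [abs_le]; constructor <;> linarith [a1.1, a1.2, hv.1, hv.2]
  have h4 : ∑ k ∈ S, |L i k - v| ≤ (3 + κ) / c * n * (|L i j - v| + δ) := by
    have hκδ : 0 ≤ κ * δ := by positivity
    have hab : 0 ≤ n * |L i j - v| := by positivity
    have hnκ : 0 ≤ κ * (n * |L i j - v|) := by positivity
    have : c * ∑ k ∈ S, |L i k - v| ≤ (3 + κ) * n * (|L i j - v| + δ) := by
      nlinarith
    calc _ = (c * ∑ k ∈ S, |L i k - v|) / c := by field_simp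
      _ ≤ ((3 + κ) * n * (|L i j - v| + δ)) / c := by gcongr
      _ = _ := by ring
  have h5 : 1 ≤ n * (|L i j - v| + δ) := by
    have : 0 ≤ n * |L i j - v| := by positivity
    linarith
  linarith

/-- The row bound is used twice: the pair `(i, j)` controls row `i`, and then by symmetry each entry
`(k, i)` controls row `k`. -/
theorem exists_total_dev_le (hβ : 0 < β) {v : ℝ} (hv : v ∈ Set.Icc (0 : ℝ) 1)
    (hψ : psi β h v = 0) :
    ∃ C, 0 ≤ C ∧ ∀ (n : ℕ) (L : Fin n → Fin n → ℝ) (δ s : ℝ), (∀ i j, L i j ∈ Set.Icc (0 : ℝ) 1) →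
      (∀ i j, L i j = L j i) → 1 ≤ n * δ → (s = 1 ∨ s = -1) →
      (∀ i j, i ≠ j → |L i j - (1 / (n : ℝ)) * ∑ k ∈ Finset.univ \ {i, j},
        phi β h (L i k) * phi β h (L j k)| ≤ δ) →
      (∀ i j, i ≠ j → -δ ≤ s * (L i j - v)) → ∀ i j, i ≠ j → |L i j - v| ≤ δ →
      ∑ i, ∑ k ∈ Finset.univ \ {i}, |L i k - v| ≤ C * δ * n ^ 2 := by
  obtain ⟨C, hC, H⟩ := exists_row_dev_le (h := h) hβ hv hψ
  refine ⟨2 * C + C * (2 * C + 1), by positivity,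
    fun n L δ s hL hsymm hn hs hΔ hside i j hij hij' => ?_⟩
  have hn0 : (0 : ℝ) < n := by exact_mod_cast Fin.pos i
  have hn1 : (1 : ℝ) ≤ n := by exact_mod_cast Fin.pos i
  have hδ : 0 ≤ δ := (abs_nonneg _).trans hij'
  have H' := H n L δ s hL hn hs hΔ hside
  have h1 : ∑ k ∈ Finset.univ \ {i}, |L i k - v| ≤ 2 * C * n * δ := by
    refine (H' i j hij).trans ?_
    have : C * n * (|L i j - v| + δ) ≤ C * n * (δ + δ) := by gcongr
    linarith
  have h2 : ∀ k ∈ (Finset.univ \ {i} : Finset (Fin n)),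
      ∑ l ∈ Finset.univ \ {k}, |L k l - v| ≤ C * n * (|L i k - v| + δ) := by
    intro k hk
    have hki : k ≠ i := by simpa using hk
    rw [hsymm i k]
    exact H' k i hki
  have h3 : ∑ k ∈ Finset.univ \ {i}, C * n * (|L i k - v| + δ) ≤ C * n * (2 * C * n * δ + n * δ) := by
    rw [← Finset.mul_sum, Finset.sum_add_distrib, Finset.sum_const, nsmul_eq_mul]
    have : ((Finset.univ \ {i} : Finset (Fin n)).card : ℝ) ≤ n := by
      exact_mod_cast (Finset.card_le_univ _).trans (Fintype.card_fin n).le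
    gcongr
  rw [← Finset.sum_sdiff (Finset.subset_univ {i}), Finset.sum_singleton]
  have h4 : 2 * C * n * δ ≤ 2 * C * n ^ 2 * δ := by
    have : (n : ℝ) ≤ n ^ 2 := by nlinarith
    gcongr
  have h5 := Finset.sum_le_sum h2
  linarith

/-- Approximate solutions of the mean-field equation are either uniformly near the transversal
root `u`, or near the tangential root `v` on average. -/
theorem exists_dichotomy {u v : ℝ} (hβ : 0 < β)
    (hroot : ∀ x, psi β h x = 0 ↔ x = u ∨ x = v) (hv : v ∈ Set.Icc (0 : ℝ) 1)
    (hd : 2 * phi β h u * (β * (phi β h u * (1 - phi β h u))) < 1) :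
    ∃ C, 0 ≤ C ∧ ∀ δ, 0 < δ → ∃ (ε : ℝ) (N : ℕ), 0 < ε ∧ ∀ (n : ℕ) (L : Fin n → Fin n → ℝ), N ≤ n →
      (∀ i j, L i j ∈ Set.Icc (0 : ℝ) 1) → (∀ i j, L i j = L j i) →
      (∀ i j, i ≠ j → |L i j - (1 / (n : ℝ)) * ∑ k ∈ Finset.univ \ {i, j},
        phi β h (L i k) * phi β h (L j k)| ≤ ε) →
      (∀ i j, i ≠ j → |L i j - u| ≤ δ) ∨
        ∑ i, ∑ k ∈ Finset.univ \ {i}, |L i k - v| ≤ C * δ * n ^ 2 := by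
  obtain ⟨C, hC, H⟩ := exists_total_dev_le hβ hv ((hroot v).2 (Or.inr rfl))
  refine ⟨C, hC, fun δ hδ => ?_⟩
  obtain ⟨ε, hε, hgap⟩ := exists_le_abs_psi hroot hδ
  obtain ⟨s1, s2⟩ := psi_sign hroot hd
  obtain ⟨N, hN⟩ := exists_nat_gt (max (4 / ε) (1 / δ))
  refine ⟨min (ε / 4) δ, N, by positivity, fun n L hNn hL hsymm hΔ => ?_⟩
  have hnN : max (4 / ε) (1 / δ) < n := hN.trans_le (by exact_mod_cast hNn)
  have hn4 : 4 / ε < n := (le_max_left _ _).trans_lt hnN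
  have hnδ : 1 ≤ n * δ := ((div_lt_iff₀ hδ).1 ((le_max_right _ _).trans_lt hnN)).le
  have hn0 : (0 : ℝ) < n := lt_trans (by positivity) hn4
  have h2n : 2 / (n : ℝ) < ε / 2 := by
    rw [div_lt_iff₀ hε] at hn4
    rw [div_lt_iff₀ hn0]; linarith
  rcases (Finset.univ : Finset (Fin n)).offDiag.eq_empty_or_nonempty with he | hne
  · left
    intro i j hij
    have : (i, j) ∈ (Finset.univ : Finset (Fin n)).offDiag := by simp [hij]
    rw [he] at this
    simp at this
  obtain ⟨⟨i, j⟩, hij, hmin⟩ := Finset.exists_min_image _ (fun q : Fin n × Fin n => L q.1 q.2) hne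
  obtain ⟨⟨i', j'⟩, hij', hmax⟩ :=
    Finset.exists_max_image _ (fun q : Fin n × Fin n => L q.1 q.2) hne
  replace hij : i ≠ j := by simpa using hij
  replace hij' : i' ≠ j' := by simpa using hij'
  replace hmin : ∀ k l, k ≠ l → L i j ≤ L k l := fun k l hkl => hmin (k, l) (by simp [hkl])
  replace hmax : ∀ k l, k ≠ l → L k l ≤ L i' j' := fun k l hkl => hmax (k, l) (by simp [hkl])
  have hmono := monotone_phi hβ.le h
  -- At the minimal entry every product `φ(L_ik)φ(L_jk)` is at least the square of `φ` there, so the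
  -- equation bounds `ψ` from above; at the maximal entry it bounds `ψ` from below.
  have hψmin : psi β h (L i j) < ε := by
    have h1 : ∑ _k ∈ Finset.univ \ {i, j}, phi β h (L i j) ^ 2 ≤
        ∑ k ∈ Finset.univ \ {i, j}, phi β h (L i k) * phi β h (L j k) := by
      refine Finset.sum_le_sum fun k hk => ?_
      have hk' : k ≠ i ∧ k ≠ j := by simpa using hk
      rw [sq]
      exact mul_le_mul (hmono (hmin i k hk'.1.symm)) (hmono (hmin j k hk'.2.symm))
        (phi_pos _ _ _).le (phi_pos _ _ _).le
    rw [Finset.sum_const, nsmul_eq_mul, card_univ_sdiff_pair hij] at h1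
    have h2 := mul_le_mul_of_nonneg_left h1 (by positivity : 0 ≤ 1 / (n : ℝ))
    have h3 := (abs_le.1 (hΔ i j hij)).1
    have h4 : 1 / (n : ℝ) * ((n - 2) * phi β h (L i j) ^ 2) =
      phi β h (L i j) ^ 2 - 2 / n * phi β h (L i j) ^ 2 := by field_simp
    have h5 : 2 / (n : ℝ) * phi β h (L i j) ^ 2 ≤ 2 / n * 1 := by
      gcongr
      exact pow_le_one₀ (phi_pos _ _ _).le (phi_lt_one _ _ _).le
    have h6 := min_le_left (ε / 4) δ
    rw [psi]
    linarith
  have hψmax : -ε < psi β h (L i' j') := by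
    have h1 : ∑ k ∈ Finset.univ \ {i', j'}, phi β h (L i' k) * phi β h (L j' k) ≤
        ∑ _k ∈ Finset.univ \ {i', j'}, phi β h (L i' j') ^ 2 := by
      refine Finset.sum_le_sum fun k hk => ?_
      have hk' : k ≠ i' ∧ k ≠ j' := by simpa using hk
      rw [sq]
      exact mul_le_mul (hmono (hmax i' k hk'.1.symm)) (hmono (hmax j' k hk'.2.symm))
        (phi_pos _ _ _).le (phi_pos _ _ _).le
    rw [Finset.sum_const, nsmul_eq_mul, card_univ_sdiff_pair hij'] at h1
    have h2 := mul_le_mul_of_nonneg_left h1 (by positivity : 0 ≤ 1 / (n : ℝ))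
    have h3 := (abs_le.1 (hΔ i' j' hij')).2
    have h4 : 1 / (n : ℝ) * ((n - 2) * phi β h (L i' j') ^ 2) =
      phi β h (L i' j') ^ 2 - 2 / n * phi β h (L i' j') ^ 2 := by field_simp
    have h5 : 0 ≤ 2 / (n : ℝ) * phi β h (L i' j') ^ 2 := by positivity
    have h6 := min_le_left (ε / 4) δ
    rw [psi]
    linarith
  have tri : ∀ x ∈ Set.Icc (0 : ℝ) 1, |x - u| < δ ∨ |x - v| < δ ∨ ε ≤ |psi β h x| := by
    intro x hx
    by_cases h1 : |x - u| < δ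
    · exact Or.inl h1
    by_cases h2 : |x - v| < δ
    · exact Or.inr (Or.inl h2)
    exact Or.inr (Or.inr (hgap x hx (not_lt.1 h1) (not_lt.1 h2)))
  have hΔ' : ∀ i j, i ≠ j → |L i j - (1 / (n : ℝ)) * ∑ k ∈ Finset.univ \ {i, j},
      phi β h (L i k) * phi β h (L j k)| ≤ δ := fun i j hij => (hΔ i j hij).trans (min_le_right _ _)
  -- Away from both roots `|ψ| ≥ ε`, so `ψ < ε` at the minimum forces `ψ < 0`, which puts the
  -- minimum at or beyond `u`. The bound on the maximum is symmetric.
  have lo : u - δ ≤ L i j ∨ |L i j - v| < δ := by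
    rcases tri _ (hL i j) with h1 | h1 | h1
    · left; linarith [(abs_lt.1 h1).1]
    · exact Or.inr h1
    · left
      have h2 : psi β h (L i j) < 0 := by
        by_contra hcon
        rw [abs_of_nonneg (not_lt.1 hcon)] at h1
        linarith
      by_contra hcon
      exact absurd (s1 _ (hL i j).1 (by linarith)) h2.not_ge
  have hi : L i' j' ≤ u + δ ∨ |L i' j' - v| < δ := by
    rcases tri _ (hL i' j') with h1 | h1 | h1
    · left; linarith [(abs_lt.1 h1).2]
    · exact Or.inr h1
    · left
      have h2 : 0 < psi β h (L i' j') := by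
        by_contra hcon
        rw [abs_of_nonpos (not_lt.1 hcon)] at h1
        linarith
      by_contra hcon
      exact absurd (s2 (L i' j') (by linarith)) h2.not_ge
  by_cases hgood : u - δ ≤ L i j ∧ L i' j' ≤ u + δ
  · left
    intro k l hkl
    rw [abs_le]
    constructor <;> linarith [hmin k l hkl, hmax k l hkl]
  · right
    -- A minimum near `v` puts all entries above `v - δ`, a maximum near `v` puts them below `v +
    -- δ`: the signs 1 and -1.
    rcases not_and_or.1 hgood with hb | hb
    · have hv' := lo.resolve_left hb
      exact H n L δ 1 hL hsymm hnδ (Or.inl rfl) hΔ' (fun k l hkl => by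
        linarith [(abs_lt.1 hv').1, hmin k l hkl]) i j hij hv'.le
    · have hv' := hi.resolve_left hb
      exact H n L δ (-1) hL hsymm hnδ (Or.inr rfl) hΔ' (fun k l hkl => by
        linarith [(abs_lt.1 hv').2, hmax k l hkl]) i' j' hij' hv'.le

end MeanField

/-! ### Concentration of the wedge densities -/

section Concentration
variable {β h u v : ℝ}

theorem sqrt_natCast_le (n : ℕ) : Real.sqrt n ≤ n := by
  rw [Real.sqrt_le_iff]
  exact ⟨Nat.cast_nonneg n, by exact_mod_cast Nat.le_self_pow two_ne_zero n⟩

theorem exists_exp_neg_sq_le {a : ℝ} (ha : 0 < a) (b : ℝ) :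
    ∃ K : ℝ, 0 ≤ K ∧ ∀ n : ℕ, 0 < n → Real.exp (-a * n ^ 2 + b * n) ≤ K / Real.sqrt n := by
  refine ⟨Real.exp ((b + 1) ^ 2 / (4 * a)), (Real.exp_pos _).le, fun n hn => ?_⟩
  have hn1 : (1 : ℝ) ≤ n := by exact_mod_cast hn
  have hs : 0 < Real.sqrt n := Real.sqrt_pos.2 (by linarith)
  have h1 : -a * n ^ 2 + b * n ≤ (b + 1) ^ 2 / (4 * a) + -(n : ℝ) := by
    have : (b + 1) ^ 2 / (4 * a) - (b + 1) * n + a * n ^ 2 = (2 * a * n - (b + 1)) ^ 2 / (4 * a) := by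
      field_simp; ring
    have : 0 ≤ (2 * a * n - (b + 1)) ^ 2 / (4 * a) := by positivity
    linarith
  have h2 : Real.exp (-(n : ℝ)) ≤ (Real.sqrt n)⁻¹ := by
    rw [Real.exp_neg]
    refine inv_anti₀ hs ?_
    have h3 := sqrt_natCast_le n
    linarith [Real.add_one_le_exp (n : ℝ)]
  calc _ ≤ Real.exp ((b + 1) ^ 2 / (4 * a)) * Real.exp (-(n : ℝ)) := by
        rw [← Real.exp_add]; exact Real.exp_le_exp.2 h1
    _ ≤ Real.exp ((b + 1) ^ 2 / (4 * a)) * (Real.sqrt n)⁻¹ := by gcongr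
    _ = _ := (div_eq_mul_inv _ _).symm

theorem inv_natCast_le_inv_sqrt {n : ℕ} (hn : 0 < n) : 1 / (n : ℝ) ≤ 1 / Real.sqrt n := by
  have hn1 : (1 : ℝ) ≤ n := by exact_mod_cast hn
  have hs : 0 < Real.sqrt n := Real.sqrt_pos.2 (by linarith)
  exact one_div_le_one_div_of_le hs (sqrt_natCast_le n)

/-- The wedge densities are uniformly close to `u` with high probability. -/
theorem exists_gibbsProb_bad_le (hβ : 0 < β) (huv : u ≠ v)
    (hroot : ∀ x, psi β h x = 0 ↔ x = u ∨ x = v)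
    (hu : u ∈ Set.Ioo (0 : ℝ) 1) (hv : v ∈ Set.Ioo (0 : ℝ) 1)
    (hd : 2 * phi β h u * (β * (phi β h u * (1 - phi β h u))) < 1) {δ₀ : ℝ} (hδ₀ : 0 < δ₀) :
    ∃ K : ℝ, 0 ≤ K ∧ ∀ n : ℕ, 0 < n →
      gibbsProb β h {G : SimpleGraph (Fin n) | ∀ i j, i ≠ j → |wedge G i j - u| ≤ δ₀}ᶜ ≤
        K / Real.sqrt n := by
  have hgap := freeEnergy_lt hβ huv hroot hu hv.1 hd
  set g := freeEnergy β h u - freeEnergy β h v with hg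
  have hg0 : 0 < g := sub_pos.2 hgap
  obtain ⟨Cd, hCd, hdich⟩ := exists_dichotomy hβ hroot ⟨hv.1.le, hv.2.le⟩ hd
  obtain ⟨Cf, hCf, hfluct⟩ := exists_fluct_bounds hβ.le h
  obtain ⟨Cl, hCl, hlow⟩ := freeEnergy_lower hβ.le ((hroot u).2 (Or.inl rfl))
  -- Chosen so that the error `β(1+β)τ` in the upper bound for configurations near `v` uses only
  -- half of the free energy gap `g`.
  set τ := g / (2 * (β * (1 + β))) with hτ
  have hτ0 : 0 < τ := by positivity
  have hτg : β * (1 + β) * τ = g / 2 := by rw [hτ]; field_simp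
  set δ := min δ₀ (τ / (Cd + 1)) with hδ
  have hδ0 : 0 < δ := by positivity
  have hCdδ : Cd * δ ≤ τ := by
    calc Cd * δ ≤ (Cd + 1) * (τ / (Cd + 1)) := by
          gcongr
          · linarith
          · exact min_le_right _ _
      _ = τ := by field_simp
  obtain ⟨ε, N, hε, hN⟩ := hdich δ hδ0
  obtain ⟨Ke, hKe, hexp⟩ := exists_exp_neg_sq_le (half_pos hg0) (β + Cl)
  -- The term `√N` makes the bound trivial for `n < N`; the others belong to the three bad events: a
  -- large wedge defect, a large edge fluctuation, and average closeness to `v`.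
  refine ⟨Cf / ε ^ 6 + Cf / τ + Ke + Real.sqrt N, by positivity, fun n hn => ?_⟩
  have hn0 : (0 : ℝ) < n := by exact_mod_cast hn
  have hs : 0 < Real.sqrt n := Real.sqrt_pos.2 hn0
  rcases lt_or_ge n N with hlt | hge
  · refine (gibbsProb_le_one _).trans ?_
    rw [le_div_iff₀ hs, one_mul]
    have h1 : Real.sqrt n ≤ Real.sqrt N := Real.sqrt_le_sqrt (by exact_mod_cast hlt.le)
    have : 0 ≤ Cf / ε ^ 6 + Cf / τ + Ke := by positivity
    linarith
  obtain ⟨hΔ, hedge⟩ := hfluct n hn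
  set A₁ : Fin n × Fin n → Set (SimpleGraph (Fin n)) := fun q =>
    {G | q.1 ≠ q.2 ∧ ε < |wedgeFluct β h G q.1 q.2|} with hA₁
  set A₂ : Set (SimpleGraph (Fin n)) := {G | τ * n ^ 2 < |edgeFluct β h G|} with hA₂
  set A₃ : Set (SimpleGraph (Fin n)) :=
    {G | |edgeFluct β h G| ≤ τ * n ^ 2 ∧ wedgeDev v G ≤ τ * n ^ 2} with hA₃
  have hsub : {G : SimpleGraph (Fin n) | ∀ i j, i ≠ j → |wedge G i j - u| ≤ δ₀}ᶜ ⊆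
      ((⋃ q, A₁ q) ∪ A₂) ∪ A₃ := by
    intro G hG
    by_cases h1 : G ∈ ⋃ q, A₁ q
    · exact Or.inl (Or.inl h1)
    by_cases h2 : G ∈ A₂
    · exact Or.inl (Or.inr h2)
    right
    have h1' : ∀ i j, i ≠ j → |wedgeFluct β h G i j| ≤ ε := by
      intro i j hij
      by_contra hcon
      exact h1 (Set.mem_iUnion.2 ⟨(i, j), hij, not_le.1 hcon⟩)
    rcases hN n (wedge G) hge (fun i j => ⟨wedge_nonneg G i j, wedge_le_one G i j⟩)
      (wedge_symm G) h1' with h3 | h3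
    · exact absurd (fun i j hij => (h3 i j hij).trans (min_le_left _ _)) hG
    · exact ⟨not_lt.1 h2, h3.trans (by gcongr)⟩
  have p1 : gibbsProb β h (⋃ q, A₁ q) ≤ Cf / ε ^ 6 / Real.sqrt n := by
    have hq : ∀ q, gibbsProb β h (A₁ q) ≤ Cf / n ^ 3 / ε ^ 6 := by
      intro q
      by_cases hne : q.1 = q.2
      · have : A₁ q = ∅ := by ext G; simp [hA₁, hne]
        rw [this, gibbsProb, Set.indicator_empty, gibbsExp_const]
        positivity
      · refine (gibbsProb_le_div (f := fun G => wedgeFluct β h G q.1 q.2 ^ 6)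
          (fun G => by positivity) (by positivity : 0 < ε ^ 6) fun G hG => ?_).trans ?_
        · rw [← abs_of_nonneg (by positivity : 0 ≤ wedgeFluct β h G q.1 q.2 ^ 6), abs_pow]
          exact pow_le_pow_left₀ hε.le hG.2.le 6
        · gcongr
          exact (hΔ q.1 q.2 hne).1
    refine (gibbsProb_iUnion_le A₁).trans ((Finset.sum_le_sum fun q _ => hq q).trans ?_)
    rw [Finset.sum_const, Finset.card_univ, Fintype.card_prod, Fintype.card_fin, nsmul_eq_mul]
    calc _ = Cf / ε ^ 6 * (1 / n) := by push_cast; field_simp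
      _ ≤ Cf / ε ^ 6 * (1 / Real.sqrt n) := by
          gcongr Cf / ε ^ 6 * ?_
          exact inv_natCast_le_inv_sqrt hn
      _ = _ := by ring
  have p2 : gibbsProb β h A₂ ≤ Cf / τ / Real.sqrt n := by
    refine (gibbsProb_le_div (f := fun G => |edgeFluct β h G|) (fun G => abs_nonneg _)
      (by positivity : 0 < τ * n ^ 2) fun G hG => le_of_lt hG).trans ?_
    calc _ ≤ Cf * (n * Real.sqrt n) / (τ * n ^ 2) := by gcongr
      _ = _ := by
          rw [div_div, div_eq_div_iff (by positivity) (by positivity)]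
          linear_combination (Cf * n * τ) * Real.mul_self_sqrt hn0.le
  -- The contribution of `A₃` to `Z_n` is compared with the lower bound for `Z_n` at `u`; the
  -- quotient is `exp(-gn²/2 + O(n))`.
  have p3 : gibbsProb β h A₃ ≤ Ke / Real.sqrt n := by
    have h1 := gibbsProb_mul_partitionFn_near_le hβ.le ((hroot v).2 (Or.inr rfl)) hv.2.le hn
      (A := A₃) (fun G hG => hG)
    have h2 := hlow n hn
    rw [Real.le_log_iff_exp_le (partitionFn_pos β h n)] at h2
    have h3 : gibbsProb β h A₃ * Real.exp (n ^ 2 * freeEnergy β h u - Cl * n) ≤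
        Real.exp (n ^ 2 * (freeEnergy β h v + β * (1 + β) * τ) + β * n) :=
      (mul_le_mul_of_nonneg_left h2 (gibbsProb_nonneg A₃)).trans h1
    rw [← le_div_iff₀ (Real.exp_pos _), ← Real.exp_sub] at h3
    refine h3.trans (le_trans (le_of_eq ?_) (hexp n hn))
    congr 1
    rw [hτg, hg]; ring
  calc _ ≤ _ := gibbsProb_mono hsub
    _ ≤ _ := gibbsProb_union_le _ _
    _ ≤ _ := add_le_add_left (gibbsProb_union_le _ _) _
    _ ≤ Cf / ε ^ 6 / Real.sqrt n + Cf / τ / Real.sqrt n + Ke / Real.sqrt n := by linarith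
    _ ≤ _ := by
        rw [← add_div, ← add_div]
        exact div_le_div_of_nonneg_right (by linarith [Real.sqrt_nonneg N]) hs.le

/-- On the event of uniform closeness the mean-field map contracts with factor `2Λ < 1`. Off it the
deviation is at most 1, which costs only the probability of the complement. -/
theorem exists_gibbsExp_abs_wedge_sub_le (hβ : 0 < β) (huv : u ≠ v)
    (hroot : ∀ x, psi β h x = 0 ↔ x = u ∨ x = v)
    (hu : u ∈ Set.Ioo (0 : ℝ) 1) (hv : v ∈ Set.Ioo (0 : ℝ) 1)
    (hd : 2 * phi β h u * (β * (phi β h u * (1 - phi β h u))) < 1) :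
    ∃ K : ℝ, 0 ≤ K ∧ ∀ (n : ℕ) (i j : Fin n), i ≠ j →
      gibbsExp β h (fun G : SimpleGraph (Fin n) => |wedge G i j - u|) ≤ K / Real.sqrt n := by
  obtain ⟨Λ, δ, hΛ, hΛ2, hδ, hcontr⟩ := exists_abs_phi_mul_phi_sub_le hβ.le hd
  obtain ⟨Kb, hKb, hbad⟩ := exists_gibbsProb_bad_le hβ huv hroot hu hv hd hδ
  obtain ⟨Cf, hCf, hfluct⟩ := exists_fluct_bounds hβ.le h
  have hpu : phi β h u ^ 2 = u := by
    have := (hroot u).2 (Or.inl rfl); rw [psi] at this; linarith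
  have h2Λ : 0 < 1 - 2 * Λ := by linarith
  refine ⟨(Cf + 2 + Kb) / (1 - 2 * Λ), by positivity, fun n i₀ j₀ hij₀ => ?_⟩
  have hn : 0 < n := Fin.pos i₀
  have hn0 : (0 : ℝ) < n := by exact_mod_cast hn
  have hs : 0 < Real.sqrt n := Real.sqrt_pos.2 hn0
  set good : Set (SimpleGraph (Fin n)) := {G | ∀ i j, i ≠ j → |wedge G i j - u| ≤ δ} with hgood
  have hpt : ∀ i j : Fin n, i ≠ j → ∀ G : SimpleGraph (Fin n), |wedge G i j - u| ≤
      |wedgeFluct β h G i j| + (1 / (n : ℝ)) * ∑ k ∈ Finset.univ \ {i, j},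
        Λ * (|wedge G i k - u| + |wedge G j k - u|) + 2 / n + goodᶜ.indicator 1 G := by
    intro i j hij G
    have hnn : 0 ≤ (1 / (n : ℝ)) * ∑ k ∈ Finset.univ \ {i, j},
        Λ * (|wedge G i k - u| + |wedge G j k - u|) :=
      mul_nonneg (by positivity) (Finset.sum_nonneg fun k _ => by positivity)
    by_cases hG : G ∈ good
    · have e : wedge G i j - u = wedgeFluct β h G i j + (1 / (n : ℝ)) *
          ∑ k ∈ Finset.univ \ {i, j},
            (phi β h (wedge G i k) * phi β h (wedge G j k) - phi β h u ^ 2) - 2 / n * u := by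
        rw [Finset.sum_sub_distrib, Finset.sum_const, nsmul_eq_mul, card_univ_sdiff_pair hij,
          wedgeFluct, hpu]
        field_simp; ring
      have h1 : |(1 / (n : ℝ)) * ∑ k ∈ Finset.univ \ {i, j},
            (phi β h (wedge G i k) * phi β h (wedge G j k) - phi β h u ^ 2)| ≤
          (1 / (n : ℝ)) * ∑ k ∈ Finset.univ \ {i, j},
            Λ * (|wedge G i k - u| + |wedge G j k - u|) := by
        rw [abs_mul, abs_of_nonneg (by positivity : 0 ≤ 1 / (n : ℝ))]
        gcongr
        refine (Finset.abs_sum_le_sum_abs _ _).trans (Finset.sum_le_sum fun k hk => ?_)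
        have hk' : k ≠ i ∧ k ≠ j := by simpa using hk
        exact hcontr _ _ (hG i k hk'.1.symm) (hG j k hk'.2.symm)
      have h2 : |2 / n * u| ≤ 2 / (n : ℝ) := by
        rw [abs_of_nonneg (by have := hu.1.le; positivity)]
        exact mul_le_of_le_one_right (by positivity) hu.2.le
      have h3 : goodᶜ.indicator (1 : SimpleGraph (Fin n) → ℝ) G = 0 :=
        Set.indicator_of_notMem (Set.notMem_compl_iff.2 hG) _
      rw [h3, add_zero, e]
      exact (abs_sub _ _).trans (add_le_add ((abs_add_le _ _).trans (add_le_add le_rfl h1)) h2)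
    · have h3 : goodᶜ.indicator (1 : SimpleGraph (Fin n) → ℝ) G = 1 :=
        Set.indicator_of_mem (show G ∈ goodᶜ from hG) _
      have h4 : |wedge G i j - u| ≤ 1 := by
        rw [abs_le]
        constructor <;> linarith [wedge_nonneg G i j, wedge_le_one G i j, hu.1, hu.2]
      have h5 : 0 ≤ |wedgeFluct β h G i j| + 2 / (n : ℝ) := by positivity
      linarith
  set m : Fin n → Fin n → ℝ := fun i j => gibbsExp β h (fun G => |wedge G i j - u|) with hm
  -- Taking the pair with the largest expected deviation closes the recursion without appeal to
  -- exchangeability.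
  obtain ⟨⟨i, j⟩, hij, hmax⟩ := Finset.exists_max_image (Finset.univ : Finset (Fin n)).offDiag
    (fun q : Fin n × Fin n => m q.1 q.2) ⟨(i₀, j₀), by simp [hij₀]⟩
  replace hij : i ≠ j := by simpa using hij
  replace hmax : ∀ k l, k ≠ l → m k l ≤ m i j := fun k l hkl => hmax (k, l) (by simp [hkl])
  refine (hmax i₀ j₀ hij₀).trans ?_
  have hM0 : 0 ≤ m i j := gibbsExp_nonneg fun G => abs_nonneg _
  have h1 : m i j ≤ gibbsExp β h (fun G => |wedgeFluct β h G i j|) + (1 / (n : ℝ)) *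
      ∑ k ∈ Finset.univ \ {i, j}, Λ * (m i k + m j k) + 2 / n + gibbsProb β h goodᶜ := by
    refine (gibbsExp_mono (hpt i j hij)).trans (le_of_eq ?_)
    simp only [gibbsExp_add, gibbsExp_const_mul, gibbsExp_sum, gibbsExp_const, gibbsProb, hm]
  have h2 : (1 / (n : ℝ)) * ∑ k ∈ Finset.univ \ {i, j}, Λ * (m i k + m j k) ≤ 2 * Λ * m i j := by
    have : ∑ k ∈ Finset.univ \ {i, j}, Λ * (m i k + m j k) ≤ n * (Λ * (m i j + m i j)) := by
      refine (Finset.sum_le_sum (g := fun _ => Λ * (m i j + m i j)) fun k hk => ?_).trans ?_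
      · have hk' : k ≠ i ∧ k ≠ j := by simpa using hk
        have a1 := hmax i k hk'.1.symm
        have a2 := hmax j k hk'.2.symm
        gcongr
      · rw [Finset.sum_const, nsmul_eq_mul, card_univ_sdiff_pair hij]
        gcongr
        linarith
    calc _ ≤ (1 / (n : ℝ)) * (n * (Λ * (m i j + m i j))) := by gcongr
      _ = _ := by field_simp; ring
  have h3 := ((hfluct n hn).1 i j hij).2
  have h4 := hbad n hn
  have h5 : 2 / (n : ℝ) ≤ 2 / Real.sqrt n := by
    have := inv_natCast_le_inv_sqrt hn
    calc 2 / (n : ℝ) = 2 * (1 / n) := by ring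
      _ ≤ 2 * (1 / Real.sqrt n) := by linarith
      _ = _ := by ring
  have h6 : (1 - 2 * Λ) * m i j ≤ (Cf + 2 + Kb) / Real.sqrt n := by
    rw [add_div, add_div]; linarith
  rw [div_right_comm, le_div_iff₀ h2Λ]
  linarith

end Concentration

/-! ### Free energy asymptotics and the triangle large deviation -/

section FreeEnergy
variable {β h u : ℝ}

theorem relEnt_pos {p q : ℝ} (hp : p ∈ Set.Ioo (0 : ℝ) 1) (hq : q ∈ Set.Ioo (0 : ℝ) 1)
    (hpq : p ≠ q) : 0 < relEnt p q := by
  have h1 : 0 < 1 - p := sub_pos.2 hp.2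
  have h2 : 0 < 1 - q := sub_pos.2 hq.2
  have a1 : Real.log (q / p) < q / p - 1 :=
    Real.log_lt_sub_one_of_pos (div_pos hq.1 hp.1) fun e => hpq ((div_eq_one_iff_eq hp.1.ne').1 e).symm
  have a2 : Real.log ((1 - q) / (1 - p)) ≤ (1 - q) / (1 - p) - 1 :=
    Real.log_le_sub_one_of_pos (div_pos h2 h1)
  have b1 := mul_lt_mul_of_pos_left a1 hp.1
  have b2 := mul_le_mul_of_nonneg_left a2 h1.le
  rw [mul_sub, mul_div_cancel₀ _ hp.1.ne'] at b1
  rw [mul_sub, mul_div_cancel₀ _ h1.ne'] at b2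
  rw [relEnt, ← inv_div q p, ← inv_div (1 - q), Real.log_inv, Real.log_inv]
  linarith

theorem freeEnergy_eq_relEnt (hu : psi β h u = 0) :
    freeEnergy β h u = -(1 / 2) * relEnt (phi β h u) (phi β h 0)
      - (1 / 2) * Real.log (1 - phi β h 0) + β * phi β h u ^ 3 / 6 := by
  have hp0 := phi_pos β h u
  have hp1 := sub_pos.2 (phi_lt_one β h u)
  have hq0 := phi_pos β h 0
  have hq1 := sub_pos.2 (phi_lt_one β h 0)
  rw [relEnt, Real.log_div hp0.ne' hq0.ne', Real.log_div hp1.ne' hq1.ne', log_phi β h u,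
    log_phi β h 0, freeEnergy, ← neg_eq_iff_eq_neg.2 (log_one_sub_phi β h u)]
  have : u = phi β h u ^ 2 := by rw [psi] at hu; linarith
  linear_combination (β * phi β h u / 2) * this

theorem gibbsExp_wedgeDev_le {K : ℝ}
    (hL : ∀ (n : ℕ) (i j : Fin n), i ≠ j →
      gibbsExp β h (fun G : SimpleGraph (Fin n) => |wedge G i j - u|) ≤ K / Real.sqrt n)
    (hK : 0 ≤ K) {n : ℕ} (hn : 0 < n) :
    gibbsExp β h (fun G : SimpleGraph (Fin n) => wedgeDev u G) ≤ K * (n * Real.sqrt n) := by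
  have hn0 : (0 : ℝ) < n := by exact_mod_cast hn
  have hs : 0 < Real.sqrt n := Real.sqrt_pos.2 hn0
  simp only [wedgeDev, gibbsExp_sum]
  calc _ ≤ ∑ i : Fin n, ∑ _k ∈ Finset.univ \ {i}, K / Real.sqrt n :=
        Finset.sum_le_sum fun i _ => Finset.sum_le_sum fun k hk => hL n i k (by
          have : k ≠ i := by simpa using hk
          exact this.symm)
    _ = (n * (n - 1)) * (K / Real.sqrt n) := sum_offDiag_const _
    _ ≤ (n * n) * (K / Real.sqrt n) := by gcongr; linarith
    _ = _ := by
        field_simp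
        linear_combination -K * Real.sq_sqrt hn0.le

/-- By Markov's inequality the configurations near `u` with tolerance `τ` of order `n^(-1/2)` carry
at least half of `Z_n`, so the upper bound for their contribution bounds `Z_n` itself. -/
theorem exists_abs_log_partitionFn_sub_le (hβ : 0 ≤ β) (hu : psi β h u = 0) (hu1 : u ≤ 1) {K : ℝ}
    (hK : 0 ≤ K)
    (hL : ∀ (n : ℕ) (i j : Fin n), i ≠ j →
      gibbsExp β h (fun G : SimpleGraph (Fin n) => |wedge G i j - u|) ≤ K / Real.sqrt n) :
    ∃ K' : ℝ, 0 ≤ K' ∧ ∀ n : ℕ, 0 < n →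
      |Real.log (partitionFn n β h) - n ^ 2 * freeEnergy β h u| ≤ K' * (n * Real.sqrt n) := by
  obtain ⟨Cf, hCf, hfluct⟩ := exists_fluct_bounds hβ h
  obtain ⟨Cl, hCl, hlow⟩ := freeEnergy_lower hβ hu
  set M := 4 * Cf + 4 * K + 1 with hM
  have hM0 : 0 < M := by positivity
  refine ⟨Cl + β * (1 + β) * M + β + Real.log 2, by
    have := Real.log_nonneg one_le_two; positivity, fun n hn => ?_⟩
  have hn0 : (0 : ℝ) < n := by exact_mod_cast hn
  have hn1 : (1 : ℝ) ≤ n := by exact_mod_cast hn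
  have hs : 0 < Real.sqrt n := Real.sqrt_pos.2 hn0
  have hs1 : 1 ≤ Real.sqrt n := Real.one_le_sqrt.2 hn1
  have hnr : (n : ℝ) ≤ n * Real.sqrt n := le_mul_of_one_le_right hn0.le hs1
  have hr : 0 < n * Real.sqrt n := by positivity
  have hτ : M / Real.sqrt n * n ^ 2 = M * (n * Real.sqrt n) := by
    field_simp
    exact (Real.sq_sqrt hn0.le).symm
  set A : Set (SimpleGraph (Fin n)) := {G | |edgeFluct β h G| ≤ M / Real.sqrt n * n ^ 2 ∧
    wedgeDev u G ≤ M / Real.sqrt n * n ^ 2} with hA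
  have hAc : gibbsProb β h Aᶜ ≤ 1 / 2 := by
    have hsub : Aᶜ ⊆ {G | M * (n * Real.sqrt n) ≤ |edgeFluct β h G| + wedgeDev u G} := by
      intro G hG
      have h0 := wedgeDev_nonneg u G
      have h0' := abs_nonneg (edgeFluct β h G)
      by_contra hcon
      rw [Set.mem_ofPred_eq, not_le] at hcon
      exact hG ⟨by rw [hτ]; linarith, by rw [hτ]; linarith⟩
    refine (gibbsProb_mono hsub).trans ?_
    refine (gibbsProb_le_div (f := fun G => |edgeFluct β h G| + wedgeDev u G)
      (fun G => add_nonneg (abs_nonneg _) (wedgeDev_nonneg u G))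
      (by positivity : 0 < M * (n * Real.sqrt n)) fun G hG => hG).trans ?_
    rw [gibbsExp_add, div_le_iff₀ (by positivity)]
    have a1 := (hfluct n hn).2
    have a2 := gibbsExp_wedgeDev_le hL hK hn
    have : 0 ≤ (Cf + K) * (n * Real.sqrt n) := by positivity
    nlinarith
  have hA2 : 1 / 2 ≤ gibbsProb β h A := by rw [gibbsProb_compl] at hAc; linarith
  have hZ := partitionFn_pos β h n
  have hup := gibbsProb_mul_partitionFn_near_le hβ hu hu1 hn (A := A) (fun G hG => hG)
  have hup2 : partitionFn n β h / 2 ≤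
      Real.exp (n ^ 2 * (freeEnergy β h u + β * (1 + β) * (M / Real.sqrt n)) + β * n) := by
    refine le_trans ?_ hup
    have := mul_le_mul_of_nonneg_right hA2 hZ.le
    linarith
  rw [← Real.log_le_iff_le_exp (by positivity), Real.log_div hZ.ne' two_ne_zero] at hup2
  have e : (n : ℝ) ^ 2 * (freeEnergy β h u + β * (1 + β) * (M / Real.sqrt n)) =
      n ^ 2 * freeEnergy β h u + β * (1 + β) * M * (n * Real.sqrt n) := by
    linear_combination β * (1 + β) * hτ
  rw [e] at hup2
  have hl := hlow n hn
  have b1 : Cl * n ≤ Cl * (n * Real.sqrt n) := by gcongr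
  have b2 : β * n ≤ β * (n * Real.sqrt n) := by gcongr
  have hlog2 := Real.log_nonneg one_le_two
  have b3 : Real.log 2 ≤ Real.log 2 * (n * Real.sqrt n) :=
    le_mul_of_one_le_right hlog2 (hn1.trans hnr)
  have b4 : 0 ≤ β * (1 + β) * M * (n * Real.sqrt n) := by positivity
  have b5 : 0 ≤ β * (n * Real.sqrt n) := by positivity
  have b6 : 0 ≤ Cl * (n * Real.sqrt n) := by positivity
  have b7 : 0 ≤ Real.log 2 * (n * Real.sqrt n) := by positivity
  rw [abs_le]
  constructor <;> linarith

theorem abs_six_mul_choose_three_sub_le (n : ℕ) :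
    |6 * (n.choose 3 : ℝ) - (n : ℝ) ^ 3| ≤ 3 * (n : ℝ) ^ 2 := by
  have h1 : 6 * (n.choose 3 : ℝ) = n * (n - 1) * (n - 2) := by
    induction n with
    | zero => simp
    | succ k ih =>
      rw [Nat.choose_succ_succ' k 2]
      push_cast
      rw [mul_add, ih, Nat.cast_choose_two]
      ring
  rw [h1, abs_le]
  have h0 : (0 : ℝ) ≤ n := Nat.cast_nonneg n
  constructor
  · nlinarith
  · rcases Nat.eq_zero_or_pos n with rfl | hn
    · simp
    · have : (1 : ℝ) ≤ n := by exact_mod_cast hn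
      nlinarith

theorem exists_gibbsExp_abs_numTriangles_sub_le (hβ : 0 ≤ β) (hu : psi β h u = 0) (hu1 : u ≤ 1)
    {K : ℝ} (hK : 0 ≤ K)
    (hL : ∀ (n : ℕ) (i j : Fin n), i ≠ j →
      gibbsExp β h (fun G : SimpleGraph (Fin n) => |wedge G i j - u|) ≤ K / Real.sqrt n) :
    ∃ K' : ℝ, 0 ≤ K' ∧ ∀ n : ℕ, 0 < n →
      gibbsExp β h (fun G : SimpleGraph (Fin n) =>
        |numTriangles G - n ^ 3 * phi β h u ^ 3 / 6|) ≤ K' * (n ^ 2 * Real.sqrt n) := by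
  obtain ⟨Cf, hCf, hfluct⟩ := exists_fluct_bounds hβ h
  refine ⟨K + Cf + β * K + 1, by positivity, fun n hn => ?_⟩
  have hn0 : (0 : ℝ) < n := by exact_mod_cast hn
  have hs1 : 1 ≤ Real.sqrt n := Real.one_le_sqrt.2 (by exact_mod_cast hn)
  have hup : u = phi β h u ^ 2 := by rw [psi] at hu; linarith
  have hu0 : 0 ≤ u := by rw [hup]; positivity
  have hpt : ∀ G : SimpleGraph (Fin n), |numTriangles G - n ^ 3 * phi β h u ^ 3 / 6| ≤
      n * ((1 + β) * wedgeDev u G + |edgeFluct β h G| + n) := by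
    intro G
    have a1 := abs_six_mul_numTriangles_sub_le u G
    have a2 := abs_two_mul_numEdges_sub_le (h := h) hβ u G
    have e : numTriangles G - n ^ 3 * phi β h u ^ 3 / 6 =
        ((6 * numTriangles G - n * u * (2 * numEdges G)) +
          n * u * (2 * numEdges G - n ^ 2 * phi β h u)) / 6 := by
      linear_combination (n ^ 3 * phi β h u / 6) * hup
    have a3 : |n * u * (2 * numEdges G - n ^ 2 * phi β h u)| ≤
        n * (|edgeFluct β h G| + β * wedgeDev u G + n) := by
      rw [abs_mul, abs_of_nonneg (by positivity : 0 ≤ n * u)]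
      calc _ ≤ n * 1 * (|edgeFluct β h G| + β * wedgeDev u G + n) := by gcongr
        _ = _ := by ring
    rw [e, abs_div, abs_of_pos (by norm_num : (0 : ℝ) < 6)]
    have a4 := abs_add_le (6 * numTriangles G - n * u * (2 * numEdges G))
      (n * u * (2 * numEdges G - n ^ 2 * phi β h u))
    have a5 := abs_nonneg (6 * numTriangles G - n * u * (2 * numEdges G) +
      n * u * (2 * numEdges G - n ^ 2 * phi β h u))
    have a6 := div_le_self a5 (by norm_num : (1 : ℝ) ≤ 6)
    linarith
  refine (gibbsExp_mono hpt).trans ?_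
  rw [gibbsExp_const_mul, gibbsExp_add, gibbsExp_add, gibbsExp_const_mul, gibbsExp_const]
  have a1 := (hfluct n hn).2
  have a2 := gibbsExp_wedgeDev_le hL hK hn
  have hnr : (n : ℝ) ≤ n * Real.sqrt n := le_mul_of_one_le_right hn0.le hs1
  calc _ ≤ n * ((1 + β) * (K * (n * Real.sqrt n)) + Cf * (n * Real.sqrt n) + n * Real.sqrt n) := by
        gcongr
    _ = _ := by ring

theorem rpow_five_halves (n : ℕ) : (n : ℝ) ^ (5 / 2 : ℝ) = n ^ 2 * Real.sqrt n := by
  rcases Nat.eq_zero_or_pos n with rfl | hn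
  · rw [Nat.cast_zero, Real.zero_rpow (by norm_num)]; simp
  · have hn0 : (0 : ℝ) < n := by exact_mod_cast hn
    rw [show (5 / 2 : ℝ) = (2 : ℕ) + 1 / 2 by norm_num, Real.rpow_add hn0, Real.rpow_natCast,
      ← Real.sqrt_eq_rpow]

/-- On the triangle event the two Hamiltonians differ by `βT/n = n²βp³/6 + O(n^(3/2))`. Changing
measure both ways gives the Erdős–Rényi probability as `Z_n(β,h)/Z_n(0,h)` times an explicit factor,
and the free energy formula turns the exponent into the relative entropy. -/
theorem exists_abs_log_gibbsProb_zero_add_le (hβ : 0 ≤ β) (hu : psi β h u = 0) (hu1 : u ≤ 1)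
    {K : ℝ} (hK : 0 ≤ K)
    (hL : ∀ (n : ℕ) (i j : Fin n), i ≠ j →
      gibbsExp β h (fun G : SimpleGraph (Fin n) => |wedge G i j - u|) ≤ K / Real.sqrt n) :
    ∃ C K' : ℝ, 0 < C ∧ 0 ≤ K' ∧ ∀ n : ℕ, 0 < n →
      0 < gibbsProb 0 h {G : SimpleGraph (Fin n) |
        |numTriangles G - (n.choose 3 : ℝ) * phi β h u ^ 3| ≤ C * (n : ℝ) ^ (5 / 2 : ℝ)} ∧
      |Real.log (gibbsProb 0 h {G : SimpleGraph (Fin n) |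
        |numTriangles G - (n.choose 3 : ℝ) * phi β h u ^ 3| ≤ C * (n : ℝ) ^ (5 / 2 : ℝ)}) +
        n ^ 2 * relEnt (phi β h u) (phi β h 0) / 2| ≤ K' * (n * Real.sqrt n) := by
  obtain ⟨Kt, hKt, htri⟩ := exists_gibbsExp_abs_numTriangles_sub_le hβ hu hu1 hK hL
  obtain ⟨Kz, hKz, hZ⟩ := exists_abs_log_partitionFn_sub_le hβ hu hu1 hK hL
  set p := phi β h u with hp
  have hp0 : 0 < p := phi_pos _ _ _
  have hp1 : p < 1 := phi_lt_one _ _ _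
  set C := 2 * Kt + 1 with hC
  set ℓ := Real.log (1 + Real.exp h) with hℓ
  have hℓ0 : 0 ≤ ℓ := Real.log_nonneg (by linarith [Real.exp_pos h])
  have hlog2 := Real.log_nonneg one_le_two
  refine ⟨C, Kz + β * (C + 1) + ℓ + Real.log 2, by positivity, by positivity, fun n hn => ?_⟩
  have hn0 : (0 : ℝ) < n := by exact_mod_cast hn
  have hn1 : (1 : ℝ) ≤ n := by exact_mod_cast hn
  have hs1 : 1 ≤ Real.sqrt n := Real.one_le_sqrt.2 hn1
  have hnr : (n : ℝ) ≤ n * Real.sqrt n := le_mul_of_one_le_right hn0.le hs1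
  have hr : 0 < n * Real.sqrt n := by positivity
  rw [rpow_five_halves]
  set A : Set (SimpleGraph (Fin n)) :=
    {G | |numTriangles G - (n.choose 3 : ℝ) * p ^ 3| ≤ C * (n ^ 2 * Real.sqrt n)} with hA
  have hch : |(n.choose 3 : ℝ) * p ^ 3 - n ^ 3 * p ^ 3 / 6| ≤ n ^ 2 * Real.sqrt n / 2 := by
    have h1 := abs_six_mul_choose_three_sub_le n
    have e : (n.choose 3 : ℝ) * p ^ 3 - n ^ 3 * p ^ 3 / 6 =
      (6 * (n.choose 3 : ℝ) - n ^ 3) * (p ^ 3 / 6) := by ring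
    rw [e, abs_mul, abs_of_nonneg (by positivity : 0 ≤ p ^ 3 / 6)]
    have hp3 : p ^ 3 ≤ 1 := pow_le_one₀ hp0.le hp1.le
    calc _ ≤ 3 * (n : ℝ) ^ 2 * (1 / 6) := by gcongr
      _ = n ^ 2 * 1 / 2 := by ring
      _ ≤ _ := by gcongr
  have hC2 : 0 < C - 1 / 2 := by linarith
  have hAc : gibbsProb β h Aᶜ ≤ 1 / 2 := by
    refine (gibbsProb_le_div (f := fun G => |numTriangles G - n ^ 3 * p ^ 3 / 6|)
      (fun G => abs_nonneg _) (by positivity : 0 < (C - 1 / 2) * (n ^ 2 * Real.sqrt n))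
      fun G hG => ?_).trans ?_
    · have hG' : C * (n ^ 2 * Real.sqrt n) < |numTriangles G - (n.choose 3 : ℝ) * p ^ 3| :=
        not_le.1 hG
      have := abs_sub_le (numTriangles G) (n ^ 3 * p ^ 3 / 6) ((n.choose 3 : ℝ) * p ^ 3)
      rw [abs_sub_comm (n ^ 3 * p ^ 3 / 6 : ℝ)] at this
      linarith
    · rw [div_le_iff₀ (by positivity)]
      refine (htri n hn).trans ?_
      have : 0 < (n : ℝ) ^ 2 * Real.sqrt n := by positivity
      nlinarith
  have hA2 : 1 / 2 ≤ gibbsProb β h A := by rw [gibbsProb_compl] at hAc; linarith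
  have hTA : ∀ G ∈ A, |β / n * numTriangles G - n ^ 2 * (β * p ^ 3 / 6)| ≤
      β * (C + 1) * (n * Real.sqrt n) := by
    intro G hG
    have h1 : |numTriangles G - n ^ 3 * p ^ 3 / 6| ≤ (C + 1) * (n ^ 2 * Real.sqrt n) := by
      have := abs_sub_le (numTriangles G) ((n.choose 3 : ℝ) * p ^ 3) (n ^ 3 * p ^ 3 / 6)
      have hG' : |numTriangles G - (n.choose 3 : ℝ) * p ^ 3| ≤ C * (n ^ 2 * Real.sqrt n) := hG
      have : 0 ≤ (n : ℝ) ^ 2 * Real.sqrt n := by positivity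
      linarith
    have e : β / n * numTriangles G - n ^ 2 * (β * p ^ 3 / 6) =
        β / n * (numTriangles G - n ^ 3 * p ^ 3 / 6) := by field_simp
    rw [e, abs_mul, abs_of_nonneg (by positivity : 0 ≤ β / n)]
    calc _ ≤ β / n * ((C + 1) * (n ^ 2 * Real.sqrt n)) := by gcongr
      _ = _ := by field_simp
  set b := β * (C + 1) * (n * Real.sqrt n) with hb
  have hlo := gibbsProb_mul_partitionFn_le (β := β) (h := h) (β' := 0) (h' := h) (A := A)
    (M := n ^ 2 * (β * p ^ 3 / 6) + b) (fun G hG => by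
      have := (abs_le.1 (hTA G hG)).2
      rw [hamiltonian_zero, hamiltonian]; linarith)
  have hhi := gibbsProb_mul_partitionFn_le (β := 0) (h := h) (β' := β) (h' := h) (A := A)
    (M := -(n ^ 2 * (β * p ^ 3 / 6)) + b) (fun G hG => by
      have := (abs_le.1 (hTA G hG)).1
      rw [hamiltonian_zero, hamiltonian]; linarith)
  have hZ0 := partitionFn_pos 0 h n
  have hZ1 := partitionFn_pos β h n
  set P := gibbsProb 0 h A with hP
  have hlo' : partitionFn n β h / 2 ≤
      P * partitionFn n 0 h * Real.exp (n ^ 2 * (β * p ^ 3 / 6) + b) := by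
    refine le_trans ?_ hlo
    have := mul_le_mul_of_nonneg_right hA2 hZ1.le
    linarith
  have hPpos : 0 < P := by
    by_contra hcon
    have : P * partitionFn n 0 h * Real.exp (n ^ 2 * (β * p ^ 3 / 6) + b) ≤ 0 :=
      mul_nonpos_of_nonpos_of_nonneg (mul_nonpos_of_nonpos_of_nonneg (not_lt.1 hcon) hZ0.le)
        (Real.exp_pos _).le
    linarith
  have hhi' : P * partitionFn n 0 h ≤
      partitionFn n β h * Real.exp (-(n ^ 2 * (β * p ^ 3 / 6)) + b) := by
    refine hhi.trans ?_
    gcongr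
    exact mul_le_of_le_one_left hZ1.le (gibbsProb_le_one A)
  have llo := Real.log_le_log (by positivity) hlo'
  have lhi := Real.log_le_log (by positivity) hhi'
  rw [Real.log_div hZ1.ne' two_ne_zero, Real.log_mul (by positivity) (Real.exp_pos _).ne',
    Real.log_mul hPpos.ne' hZ0.ne', Real.log_exp, log_partitionFn_zero, ← hℓ] at llo
  rw [Real.log_mul hZ1.ne' (Real.exp_pos _).ne', Real.log_mul hPpos.ne' hZ0.ne', Real.log_exp,
    log_partitionFn_zero, ← hℓ] at lhi
  have hz := abs_le.1 (hZ n hn)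
  have hfe := freeEnergy_eq_relEnt hu
  rw [log_one_sub_phi, mul_zero, zero_add, ← hℓ, ← hp] at hfe
  rw [hfe] at hz
  have b1 : ℓ * n ≤ ℓ * (n * Real.sqrt n) := by gcongr
  have b2 : Real.log 2 ≤ Real.log 2 * (n * Real.sqrt n) :=
    le_mul_of_one_le_right hlog2 (hn1.trans hnr)
  have b3 : 0 ≤ ℓ * n := by positivity
  have b4 : 0 ≤ Real.log 2 * (n * Real.sqrt n) := by positivity
  refine ⟨hPpos, ?_⟩
  rw [abs_le]
  constructor
  · linarith [hz.1]
  · linarith [hz.2]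

end FreeEnergy

end TriangleERG
end

/-! ### Assembly of the root structure and the three asymptotic statements. -/

theorem lemma13 (t h β : ℝ) (ht0 : 0 < t) (ht : t ≠ 1 / 2)
    (hγ : (h, β) = TriangleERG.gammaCurve t) :
    ∃ u v : ℝ,
      -- `ψ` has exactly two roots in `[0,1]`: the tangential one `v` and the other one `u`
      v = ((1 + t) ^ 2)⁻¹ ∧ u ≠ v ∧
      {x : ℝ | x ∈ Set.Icc (0 : ℝ) 1 ∧ TriangleERG.psi β h x = 0} = {u, v} ∧
      deriv (TriangleERG.psi β h) v = 0 ∧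
      (∃ K : ℝ, ∀ (n : ℕ) (i j : Fin n), i < j →
        TriangleERG.gibbsExp β h (fun G : SimpleGraph (Fin n) => |TriangleERG.wedge G i j - u|)
          ≤ K / Real.sqrt n) ∧
      (∃ K : ℝ, ∀ n : ℕ, 1 ≤ n →
        |Real.log (TriangleERG.partitionFn n β h) / (n : ℝ) ^ 2 -
          (-(1 / 2) * TriangleERG.relEnt (TriangleERG.phi β h u) (TriangleERG.phi β h 0)
            - (1 / 2) * Real.log (1 - TriangleERG.phi β h 0)
            + β * TriangleERG.phi β h u ^ 3 / 6)| ≤ K / Real.sqrt n) ∧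
      (∃ C K : ℝ, 0 < C ∧ ∀ n : ℕ, 1 ≤ n → ∃ ε : ℝ, |ε| ≤ K / Real.sqrt n ∧
        (SimpleGraph.binomialRandom (Fin n) (TriangleERG.baseProb β h)).real
            {G : SimpleGraph (Fin n) |
              |TriangleERG.numTriangles G - (n.choose 3 : ℝ) * TriangleERG.phi β h u ^ 3|
                ≤ C * (n : ℝ) ^ (5 / 2 : ℝ)}
          = Real.exp (-((n : ℝ) ^ 2 *
              TriangleERG.relEnt (TriangleERG.phi β h u) (TriangleERG.phi β h 0) / 2)
                * (1 + ε))) := by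
  obtain ⟨u, huv, hroot, hu, hd⟩ := TriangleERG.exists_transversal_root ht0 ht hγ
  have hv : ((1 + t) ^ 2)⁻¹ ∈ Set.Ioo (0 : ℝ) 1 :=
    ⟨by positivity, inv_lt_one_of_one_lt₀ (one_lt_pow₀ (by linarith) two_ne_zero)⟩
  have hβ : 0 < β := by rw [(Prod.mk.inj hγ).2]; positivity
  have hψu : TriangleERG.psi β h u = 0 := (hroot u).2 (Or.inl rfl)
  obtain ⟨K, hK, hL⟩ := TriangleERG.exists_gibbsExp_abs_wedge_sub_le hβ huv hroot hu hv hd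
  refine ⟨u, ((1 + t) ^ 2)⁻¹, rfl, huv, ?_, TriangleERG.deriv_psi_tangential ht0 hγ,
    ⟨K, fun n i j hij => hL n i j hij.ne⟩, ?_, ?_⟩
  · ext x
    simp only [Set.mem_ofPred_eq, Set.mem_insert_iff, Set.mem_singleton_iff, hroot]
    constructor
    · exact fun hx => hx.2
    · rintro (rfl | rfl)
      · exact ⟨⟨hu.1.le, hu.2.le⟩, Or.inl rfl⟩
      · exact ⟨⟨hv.1.le, hv.2.le⟩, Or.inr rfl⟩
  · obtain ⟨K', hK', hZ⟩ :=
      TriangleERG.exists_abs_log_partitionFn_sub_le hβ.le hψu hu.2.le hK hL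
    refine ⟨K', fun n hn => ?_⟩
    have hn0 : (0 : ℝ) < n := by exact_mod_cast hn
    have hs : 0 < Real.sqrt n := Real.sqrt_pos.2 hn0
    rw [← TriangleERG.freeEnergy_eq_relEnt hψu]
    have e : Real.log (TriangleERG.partitionFn n β h) / (n : ℝ) ^ 2 - TriangleERG.freeEnergy β h u =
        (Real.log (TriangleERG.partitionFn n β h) - n ^ 2 * TriangleERG.freeEnergy β h u) / n ^ 2 := by
      field_simp
    rw [e, abs_div, abs_of_pos (by positivity : (0 : ℝ) < n ^ 2), div_le_iff₀ (by positivity)]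
    refine (hZ n hn).trans (le_of_eq ?_)
    field_simp
    linear_combination K' * Real.sq_sqrt hn0.le
  · obtain ⟨C, K', hC, hK', hP⟩ :=
      TriangleERG.exists_abs_log_gibbsProb_zero_add_le hβ.le hψu hu.2.le hK hL
    set I := TriangleERG.relEnt (TriangleERG.phi β h u) (TriangleERG.phi β h 0) with hI
    -- Strict positivity, from `φ(u) > φ(0)`, is needed to express an additive error in the exponent
    -- as a relative one.
    have hI0 : 0 < I := by
      obtain ⟨c, hc, H⟩ := TriangleERG.exists_le_phi_sub_phi hβ h
      have h1 := H 0 u le_rfl hu.1.le hu.2.le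
      have h2 : 0 < c * (u - 0) := mul_pos hc (by linarith [hu.1])
      exact TriangleERG.relEnt_pos ⟨TriangleERG.phi_pos _ _ _, TriangleERG.phi_lt_one _ _ _⟩
        ⟨TriangleERG.phi_pos _ _ _, TriangleERG.phi_lt_one _ _ _⟩ (by linarith : _ < _).ne'
    refine ⟨C, 2 * K' / I, hC, fun n hn => ?_⟩
    have hn0 : (0 : ℝ) < n := by exact_mod_cast hn
    have hs : 0 < Real.sqrt n := Real.sqrt_pos.2 hn0
    obtain ⟨hpos, hlog⟩ := hP n hn
    rw [TriangleERG.binomialRandom_real_eq_gibbsProb]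
    set P := TriangleERG.gibbsProb 0 h {G : SimpleGraph (Fin n) |
      |TriangleERG.numTriangles G - (n.choose 3 : ℝ) * TriangleERG.phi β h u ^ 3|
        ≤ C * (n : ℝ) ^ (5 / 2 : ℝ)}
    -- This is the value of `ε` solving the required identity for `log P`.
    refine ⟨-(Real.log P + n ^ 2 * I / 2) * (2 / (n ^ 2 * I)), ?_, ?_⟩
    · rw [abs_mul, abs_neg, abs_of_pos (by positivity : 0 < 2 / ((n : ℝ) ^ 2 * I))]
      calc _ ≤ K' * (n * Real.sqrt n) * (2 / (n ^ 2 * I)) := by gcongr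
        _ = _ := by
          field_simp
          linear_combination K' * Real.sq_sqrt hn0.le
    · have e : -((n : ℝ) ^ 2 * I / 2) *
          (1 + -(Real.log P + n ^ 2 * I / 2) * (2 / (n ^ 2 * I))) = Real.log P := by
        field_simp
        ring
      rw [e, Real.exp_log hpos]
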